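/- **Setting.** Let $d\ge 1$ and $\gamma>1$. For the compressible Euler equations $\partial_t\mathbf u+\nabla\cdot\mathbf F(\mathbf u)=0$, $\mathbf u=(\rho,\rho\mathbf V,\rho E)$, $\mathbf F=[\rho\mathbf V,\ \rho\mathbf V\otimes\mathbf V+P\mathbf I,\ (\rho E+P)\mathbf V]$, $P=(\gamma-1)(\rho E-\tfrac12\rho|\mathbf V|^2)$, put $s=\log(P/\rho^\gamma)$, $\beta=\rho/P$, $H=-\rho s/(\gamma-1)$ (generalized entropy), and use the entropy variables $$\boldsymbol v=\frac{\partial H}{\partial\mathbf u}=\Big[\tfrac{\gamma-s}{\gamma-1}-\tfrac12\beta|\mathbf V|^2,\ \beta\mathbf V,\ -\beta\Big],$$ with inverse map $\mathbf u(\boldsymbol v)$, defined where $\beta>0$. **Mesh and spaces.** Let a $d$-dimensional periodic domain ($\mathbb R^d$ modulo a full-rank lattice) have a conforming mesh $\mathcal T_h$ of finitely many simplices, grouped into macro-elements. Let $p\ge0$. $\boldsymbol{\mathcal V}_h$ is the space of $\mathbb R^{d+2}$-valued functions that are continuous on each macro-element (discontinuous between macro-elements) and polynomial of degree $\le p$ on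 each simplex. $\boldsymbol{\mathcal M}_h$ is the space of single-valued functions on the interfaces between macro-elements that are polynomial of degree $\le p$ on each simplex face lying there, or any fixed linear subspace of that space. $\partial\mathcal T_h$ denotes the boundaries of the macro-elements, each interface being counted from both sides, and $\boldsymbol n$ the outward unit normal. **Scheme.** $\boldsymbol v_h(t)\in\boldsymbol{\mathcal V}_h$ and $\widehat{\boldsymbol v}_h(t)\in\boldsymbol{\mathcal M}_h$, $t\in[0,T]$, with $\boldsymbol v_h$ differentiable in $t$ and both in the domain $\beta>0$, satisfy for all $\boldsymbol w\in\boldsymbol{\mathcal V}_h$, $\boldsymbol\mu\in\boldsymbol{\mathcal M}_h$ and $t\in[0,T]$ $$(\partial_t\mathbf u(\boldsymbol v_h),\boldsymbol w)_{\mathcal T_h}-(\mathbf F(\mathbf u(\boldsymbol v_h)),\nabla\boldsymbol w)_{\mathcal T_h}+\langle\widehat{\mathbf F}_h,\boldsymbol w\rangle_{\partial\mathcal T_h}=0,\qquad \langle\widehat{\mathbf F}_h,\boldsymbol\mu\rangle_{\partial\mathcal T_h}=0 .$$ **KEPES flux.** Hats denote the trace state, unhatted quantities the interior state; $[\![a]\!]=\widehat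 a-a$, $\overline a=\tfrac12(a+\widehat a)$, $a^{\ln}=[\![a]\!]/\ln(\widehat a/a)$ (with value $a$ if $\widehat a=a$), $\overline P=\overline\rho/\overline\beta$. Let $\overline{\mathbf F}=(f_1,\mathbf f_2,f_3)$ with $$f_1=\rho^{\ln}\,\overline{\mathbf V}\cdot\boldsymbol n,\quad \mathbf f_2=\overline{\mathbf V}f_1+\overline P\boldsymbol n,\quad f_3=\Big(\tfrac1{\beta^{\ln}(\gamma-1)}-\tfrac12\overline{|\mathbf V|^2}\Big)f_1+\overline{\mathbf V}\cdot\mathbf f_2 ,$$ and $$\widehat{\mathbf F}_h=\overline{\mathbf F}-\tfrac12\,\overline{\boldsymbol R}\,|\overline{\boldsymbol\Lambda}|\,\overline{\boldsymbol T}\,\overline{\boldsymbol R}^{\,t}[\![\boldsymbol v_h]\!].$$ Here $\overline c=\sqrt{\gamma\overline P/\rho^{\ln}}$, $\overline h=\tfrac{\gamma}{\beta^{\ln}(\gamma-1)}+\tfrac12\overline{|\mathbf V|^2}$, $\overline{\mathrm v}_n=\overline{\mathbf V}\cdot\boldsymbol n$, and, for an orthonormal frame $(\boldsymbol e_1,\dots,\boldsymbol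 e_d)$ chosen arbitrarily for each face and side (for instance the standard one, or one with $\boldsymbol e_1=\boldsymbol n$), $\overline{\boldsymbol R}$ has the columns $$(1,\ \overline{\mathbf V}-\overline c\,\boldsymbol e_1,\ \overline h-\overline c\,\overline{\mathbf V}\cdot\boldsymbol e_1),\quad (1,\ \overline{\mathbf V},\ \tfrac12\overline{|\mathbf V|^2}),\quad (0,\ \boldsymbol e_k,\ \overline{\mathbf V}\cdot\boldsymbol e_k)_{k=2,\dots,d},\quad (1,\ \overline{\mathbf V}+\overline c\,\boldsymbol e_1,\ \overline h+\overline c\,\overline{\mathbf V}\cdot\boldsymbol e_1),$$ $\overline{\boldsymbol T}=\mathrm{diag}\big(\tfrac{\rho^{\ln}}{2\gamma},\tfrac{\rho^{\ln}(\gamma-1)}{\gamma},\overline P,\dots,\overline P,\tfrac{\rho^{\ln}}{2\gamma}\big)$, and $|\overline{\boldsymbol\Lambda}|=(1-\theta)|\overline{\boldsymbol\lambda}|+\theta|\lambda_{\max}|\boldsymbol I$ with $\overline{\boldsymbol\lambda}=\mathrm{diag}(\overline{\mathrm v}_n+\overline c,\overline{\mathrm v}_n,\dots,\overline{\mathrm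 v}_n,\overline{\mathrm v}_n+\overline c)$, $\theta=\sqrt{|(P-\widehat P)/(P+\widehat P)|}$, and $\lambda_{\max}$ the largest eigenvalue of the flux Jacobian in direction $\boldsymbol n$, taken either at the trace state ($\widehat{\mathbf V}\cdot\boldsymbol n+\sqrt{\gamma\widehat P/\widehat\rho}$) or at the averages ($\overline{\mathrm v}_n+\overline c$). **Theorem.** The scheme with the KEPES flux is entropy-stable: for every such solution $(\boldsymbol v_h,\widehat{\boldsymbol v}_h)$ the total generalized entropy $t\mapsto\int_{\mathcal T_h}H(\mathbf u(\boldsymbol v_h(t)))$ is non-increasing on $[0,T]$. -/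

import Mathlib

open MeasureTheory
open scoped Matrix

noncomputable section

namespace EulerHDG

/-! ### States of the compressible Euler equations -/

/-- Points of `ℝ^d`, with the Euclidean norm and Lebesgue measure. -/
abbrev Pt (d : ℕ) : Type := EuclideanSpace ℝ (Fin d)

/-- Index set of the `d + 2` components: mass, the `d` momentum components, energy. -/
abbrev Comp (d : ℕ) : Type := Unit ⊕ Fin d ⊕ Unit

/-- Vectors with `d + 2` components. -/
abbrev State (d : ℕ) : Type := Comp d → ℝ

variable {d : ℕ}

def mkState (a : ℝ) (m : Fin d → ℝ) (e : ℝ) : State d :=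
  Sum.elim (fun _ => a) (Sum.elim m (fun _ => e))

def massC (u : State d) : ℝ := u (Sum.inl ())
def momC (u : State d) (i : Fin d) : ℝ := u (Sum.inr (Sum.inl i))
def energyC (u : State d) : ℝ := u (Sum.inr (Sum.inr ()))

@[simp] theorem massC_mkState (a : ℝ) (m : Fin d → ℝ) (e : ℝ) : massC (mkState a m e) = a := rfl
@[simp] theorem momC_mkState (a : ℝ) (m : Fin d → ℝ) (e : ℝ) (i : Fin d) :
    momC (mkState a m e) i = m i := rfl
@[simp] theorem energyC_mkState (a : ℝ) (m : Fin d → ℝ) (e : ℝ) :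
    energyC (mkState a m e) = e := rfl

theorem mkState_components (u : State d) : mkState (massC u) (momC u) (energyC u) = u := by
  funext c
  rcases c with _ | _ | _ <;> rfl

/-- Density `ρ` of the conservative state `u = (ρ, ρV, ρE)`. -/
def density (u : State d) : ℝ := massC u

/-- Velocity `V`. -/
def velocity (u : State d) (i : Fin d) : ℝ := momC u i / massC u

/-- `V · V`. -/
def speedSq (u : State d) : ℝ := ∑ i, velocity u i ^ 2

/-- Pressure of an ideal gas, `P = (γ - 1) (ρE - ρ V·V / 2)`. -/
def pressure (γ : ℝ) (u : State d) : ℝ :=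
  (γ - 1) * (energyC u - density u * speedSq u / 2)

/-- `β = ρ / P`. -/
def betaOf (γ : ℝ) (u : State d) : ℝ := density u / pressure γ u

/-- Specific entropy `s = log (P / ρ^γ)`. -/
def specificEntropy (γ : ℝ) (u : State d) : ℝ :=
  Real.log (pressure γ u / density u ^ γ)

/-- Generalized entropy `H = - ρ s / (γ - 1)`. -/
def genEntropy (γ : ℝ) (u : State d) : ℝ :=
  -(density u * specificEntropy γ u) / (γ - 1)

/-- Entropy variables `v(u) = ∂H/∂u`. -/
def entropyVars (γ : ℝ) (u : State d) : State d :=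
  mkState ((γ - specificEntropy γ u) / (γ - 1) - betaOf γ u * (speedSq u / 2))
    (fun i => betaOf γ u * velocity u i) (-betaOf γ u)

/-- Physically admissible conservative states. -/
def Physical (γ : ℝ) (u : State d) : Prop := 0 < density u ∧ 0 < pressure γ u

/-- Admissible entropy variables: the last component is `-β`, and `β > 0`. -/
def Admissible (v : State d) : Prop := energyC v < 0

/-- The inverse map `v ↦ u(v)` on admissible entropy variables:
`β = -v_{d+2}`, `V = v_mom / β`, `s = γ - (γ-1)(v_1 + β V·V/2)`, and `ρ`, `P` are determined by
`ρ / P = β` and `P / ρ^γ = e^s`. -/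
def consVars (γ : ℝ) (v : State d) : State d :=
  let β : ℝ := -energyC v
  let V : Fin d → ℝ := fun i => momC v i / β
  let s : ℝ := γ - (γ - 1) * (massC v + β * ((∑ i, V i ^ 2) / 2))
  let ρ : ℝ := Real.exp (-(s + Real.log β) / (γ - 1))
  let P : ℝ := ρ / β
  mkState ρ (fun i => ρ * V i) (P / (γ - 1) + ρ * (∑ i, V i ^ 2) / 2)

/-- The `j`-th column of the inviscid flux `F(u) = [ρV, ρV⊗V + P I, ρV (E + P/ρ)]`. -/
def eulerFlux (γ : ℝ) (u : State d) (j : Fin d) : State d :=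
  mkState (density u * velocity u j)
    (fun i => density u * velocity u i * velocity u j + (if i = j then pressure γ u else 0))
    ((energyC u + pressure γ u) * velocity u j)

/-! ### The numerical flux

Below `vh` is the trace state `v̂`, `v` is the interior state, and the jump is `⟦a⟧ = â - a`. -/

/-- Arithmetic mean. -/
def amean (a b : ℝ) : ℝ := (a + b) / 2

/-- Logarithmic mean `⟦a⟧ / ln (â / a)`, extended by its limit value to `a = â`. -/
def logMean (a b : ℝ) : ℝ := if a = b then a else (b - a) / Real.log (b / a)

section Flux

variable (γ : ℝ) (vh v : State d)

def rhoMean : ℝ := amean (density (consVars γ v)) (density (consVars γ vh))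
def rhoLn : ℝ := logMean (density (consVars γ v)) (density (consVars γ vh))
def betaMean : ℝ := amean (betaOf γ (consVars γ v)) (betaOf γ (consVars γ vh))
def betaLn : ℝ := logMean (betaOf γ (consVars γ v)) (betaOf γ (consVars γ vh))
def velMean (i : Fin d) : ℝ := amean (velocity (consVars γ v) i) (velocity (consVars γ vh) i)
def speedSqMean : ℝ := amean (speedSq (consVars γ v)) (speedSq (consVars γ vh))

/-- Mean pressure, by definition the ratio of the means of `ρ` and `β`. -/
def pMean : ℝ := rhoMean γ vh v / betaMean γ vh v

/-- `V̄ · a` for a vector `a`. -/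
def velMeanDot (a : Pt d) : ℝ := ∑ i, velMean γ vh v i * a i

/-- The kinetic-energy-preserving, entropy-conservative flux in the direction `n`. -/
def ecFlux (n : Pt d) : State d :=
  let f₁ : ℝ := rhoLn γ vh v * velMeanDot γ vh v n
  let f₂ : Fin d → ℝ := fun i => velMean γ vh v i * f₁ + pMean γ vh v * n i
  let f₃ : ℝ := (1 / (betaLn γ vh v * (γ - 1)) - speedSqMean γ vh v / 2) * f₁
    + ∑ i, velMean γ vh v i * f₂ i
  mkState f₁ f₂ f₃

/-- Mean sound speed `c̄ = √(γ P̄ / ρ^ln)`. -/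
def cMean : ℝ := Real.sqrt (γ * pMean γ vh v / rhoLn γ vh v)

/-- `h̄ = γ / (β^ln (γ - 1)) + ½ mean(|V|²)`. -/
def hMean : ℝ := γ / (betaLn γ vh v * (γ - 1)) + speedSqMean γ vh v / 2

/-- The averaged matrix of right eigenvectors, relative to an orthonormal frame `E`.
Columns: acoustic wave, entropy wave, `d - 1` shear waves, acoustic wave.  For `d = 3` and the
standard frame it is the matrix with rows
`(1, 1, 0, 0, 1)`, `(v̄₁ - c̄, v̄₁, 0, 0, v̄₁ + c̄)`, `(v̄₂, v̄₂, 1, 0, v̄₂)`, `(v̄₃, v̄₃, 0, 1, v̄₃)`,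
`(h̄ - v̄₁ c̄, ½ mean(|V|²), v̄₂, v̄₃, h̄ + v̄₁ c̄)`;
if `E 0 = n`, its columns approximate the eigenvectors of the flux Jacobian in direction `n`. -/
def eigMatrix [NeZero d] (E : OrthonormalBasis (Fin d) ℝ (Pt d)) :
    Matrix (Comp d) (Comp d) ℝ :=
  Matrix.of fun r k =>
    match k with
    | Sum.inl _ =>
        mkState 1 (fun i => velMean γ vh v i - cMean γ vh v * E 0 i)
          (hMean γ vh v - velMeanDot γ vh v (E 0) * cMean γ vh v) r
    | Sum.inr (Sum.inl k) =>
        if k = 0 then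
          mkState 1 (fun i => velMean γ vh v i) (speedSqMean γ vh v / 2) r
        else
          mkState 0 (fun i => E k i) (velMeanDot γ vh v (E k)) r
    | Sum.inr (Sum.inr _) =>
        mkState 1 (fun i => velMean γ vh v i + cMean γ vh v * E 0 i)
          (hMean γ vh v + velMeanDot γ vh v (E 0) * cMean γ vh v) r

/-- The diagonal `T̄` scaling the eigenvectors. -/
def scaling [NeZero d] : State d :=
  mkState (rhoLn γ vh v / (2 * γ))
    (fun k => if k = 0 then rhoLn γ vh v * (γ - 1) / γ else pMean γ vh v)
    (rhoLn γ vh v / (2 * γ))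

/-- The modified eigenvalues `(v̄ₙ + c̄, v̄ₙ, …, v̄ₙ, v̄ₙ + c̄)`. -/
def kepesEigenvalues (n : Pt d) : State d :=
  mkState (velMeanDot γ vh v n + cMean γ vh v) (fun _ => velMeanDot γ vh v n)
    (velMeanDot γ vh v n + cMean γ vh v)

/-- Pressure indicator `θ`, the weight of the Lax–Friedrichs part. -/
def theta : ℝ :=
  Real.sqrt |(pressure γ (consVars γ v) - pressure γ (consVars γ vh)) /
    (pressure γ (consVars γ v) + pressure γ (consVars γ vh))|

/-- Hybrid eigenvalues `|Λ̄| = (1 - θ) |λ̄| + θ |λ_max|`. -/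
def hybridEigenvalues (lam : ℝ) (n : Pt d) : State d :=
  fun k => (1 - theta γ vh v) * |kepesEigenvalues γ vh v n k| + theta γ vh v * |lam|

/-- `λ_max` as the largest eigenvalue `V̂·n + ĉ` of the flux Jacobian in direction `n` at the
trace state, `ĉ = √(γ P̂ / ρ̂)`. -/
def lamMaxTrace (n : Pt d) : ℝ :=
  ∑ i, velocity (consVars γ vh) i * n i +
    Real.sqrt (γ * pressure γ (consVars γ vh) / density (consVars γ vh))

/-- `λ_max` as the largest of the averaged eigenvalues, `v̄ₙ + c̄`. -/
def lamMaxMean (n : Pt d) : ℝ := velMeanDot γ vh v n + cMean γ vh v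

/-- The kinetic-energy-preserving, entropy-stable flux
`F̄ - ½ R̄ |Λ̄| T̄ R̄ᵗ ⟦v⟧`. -/
def kepesFlux [NeZero d] (lam : ℝ) (E : OrthonormalBasis (Fin d) ℝ (Pt d)) (n : Pt d) : State d :=
  ecFlux γ vh v n - (1 / 2 : ℝ) •
    ((eigMatrix γ vh v E * Matrix.diagonal (hybridEigenvalues γ vh v lam n)
      * Matrix.diagonal (scaling γ vh v) * (eigMatrix γ vh v E)ᵀ) *ᵥ (vh - v))

end Flux

/-! ### Periodic macro-element meshes -/

/-- A conforming simplicial mesh of a `d`-dimensional periodic domain, whose elements are grouped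
into macro-elements.  The domain is `ℝ^d` modulo the lattice spanned by `period` (for a box with
side lengths `L_i`, the vectors `L_i e_i`).  The finitely many elements are simplices in `ℝ^d`
whose translates by the lattice tile `ℝ^d`.  A side `(K, i)` is the facet of `K` opposite to its
`i`-th vertex; it coincides, up to the translation `shift (K, i)`, with the side `nbr (K, i)` of
the adjacent element. -/
structure PeriodicMesh (d : ℕ) [NeZero d] where
  period : Module.Basis (Fin d) ℝ (Pt d)
  Elem : Type
  [fintypeElem : Fintype Elem]
  simplex : Elem → Affine.Simplex ℝ (Pt d) d
  /-- The labels of the macro-elements. -/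
  Macro : Type
  /-- The macro-element to which an element belongs. -/
  owner : Elem → Macro
  covers : ∀ x : Pt d, ∃ K : Elem, ∃ z ∈ Submodule.span ℤ (Set.range period),
    x ∈ (fun y => z + y) '' (simplex K).closedInterior
  disjoint : ∀ K K' : Elem, ∀ z ∈ Submodule.span ℤ (Set.range period), (K = K' → z ≠ 0) →
    Disjoint (interior (simplex K).closedInterior)
      ((fun y => z + y) '' interior (simplex K').closedInterior)
  nbr : Elem × Fin (d + 1) → Elem × Fin (d + 1)
  shift : Elem × Fin (d + 1) → Pt d
  shift_mem : ∀ s, shift s ∈ Submodule.span ℤ (Set.range period)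
  facet_eq : ∀ s : Elem × Fin (d + 1), ((simplex s.1).faceOpposite s.2).closedInterior =
    (fun y => shift s + y) '' ((simplex (nbr s).1).faceOpposite (nbr s).2).closedInterior
  nbr_ne : ∀ s, (nbr s).1 = s.1 → shift s ≠ 0
  nbr_nbr : ∀ s, nbr (nbr s) = s
  shift_nbr : ∀ s, shift (nbr s) = -shift s

namespace PeriodicMesh

variable [NeZero d] (𝒯 : PeriodicMesh d)

instance : Fintype 𝒯.Elem := 𝒯.fintypeElem

abbrev Side : Type := 𝒯.Elem × Fin (d + 1)

/-- The closed element `K`. -/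
def cell (K : 𝒯.Elem) : Set (Pt d) := (𝒯.simplex K).closedInterior

/-- The closed macro-element. -/
def macroCell (i : 𝒯.Macro) : Set (Pt d) := ⋃ K ∈ {K | 𝒯.owner K = i}, 𝒯.cell K

def facet (s : 𝒯.Side) : Set (Pt d) := ((𝒯.simplex s.1).faceOpposite s.2).closedInterior

/-- The unit normal of a side, outward to its element: it points from the vertex opposite to the
side to the foot of the altitude through that vertex. -/
def normal (s : 𝒯.Side) : Pt d :=
  ((𝒯.simplex s.1).height s.2)⁻¹ •
    ((𝒯.simplex s.1).altitudeFoot s.2 - (𝒯.simplex s.1).points s.2)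

/-- A side lies on the interface between macro-elements unless the adjacent element is in the same
macro-element.  (A side across which a macro-element meets a nontrivial periodic translate of
itself is on the interface.) -/
def IsInterface (s : 𝒯.Side) : Prop :=
  ¬ (𝒯.owner (𝒯.nbr s).1 = 𝒯.owner s.1 ∧ 𝒯.shift s = 0)

/-- `∫_{∂𝒯_h}`: the sum over all macro-elements of the integral over their boundary, of a function
that may depend on the side from which a point is seen.  The surface measure is the
`(d-1)`-dimensional Hausdorff measure, normalized as Euclidean area. -/
def boundaryIntegral (f : 𝒯.Side → Pt d → ℝ) : ℝ :=
  open Classical in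
  ∑ s ∈ Finset.univ.filter 𝒯.IsInterface, ∫ x in 𝒯.facet s, f s x ∂(μHE[d - 1])

/-- `∫_{𝒯_h}`. -/
def volumeIntegral (f : 𝒯.Elem → Pt d → ℝ) : ℝ :=
  ∑ K, ∫ x in 𝒯.cell K, f K x

end PeriodicMesh

/-! ### Finite element spaces -/

/-- Each component of `f` is on `D` a polynomial of total degree at most `p`. -/
def IsPolyOn (p : ℕ) (D : Set (Pt d)) (f : Pt d → State d) : Prop :=
  ∀ c, ∃ q : MvPolynomial (Fin d) ℝ, q.totalDegree ≤ p ∧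
    ∀ x ∈ D, f x c = MvPolynomial.eval (fun i => x i) q

theorem IsPolyOn.zero (p : ℕ) (D : Set (Pt d)) : IsPolyOn p D (0 : Pt d → State d) :=
  fun _ => ⟨0, by simp, fun _ _ => by simp⟩

theorem IsPolyOn.add {p : ℕ} {D : Set (Pt d)} {f g : Pt d → State d}
    (hf : IsPolyOn p D f) (hg : IsPolyOn p D g) : IsPolyOn p D (f + g) := by
  intro c
  obtain ⟨q, hq, hq'⟩ := hf c
  obtain ⟨r, hr, hr'⟩ := hg c
  exact ⟨q + r, (MvPolynomial.totalDegree_add q r).trans (max_le hq hr),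
    fun x hx => by simp [hq' x hx, hr' x hx]⟩

theorem IsPolyOn.smul {p : ℕ} {D : Set (Pt d)} (a : ℝ) {f : Pt d → State d}
    (hf : IsPolyOn p D f) : IsPolyOn p D (a • f) := by
  intro c
  obtain ⟨q, hq, hq'⟩ := hf c
  exact ⟨a • q, (MvPolynomial.totalDegree_smul_le a q).trans hq,
    fun x hx => by simp [hq' x hx]⟩

namespace PeriodicMesh

variable [NeZero d] (𝒯 : PeriodicMesh d)

/-- The space `𝒱_h`: continuous on each macro-element, polynomial of degree at most `p` on each
element, with no continuity between macro-elements.  A member is a family of functions, one for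
each macro-element; only the values on the respective macro-element matter. -/
def volumeSpace (p : ℕ) : Submodule ℝ (𝒯.Macro → Pt d → State d) where
  carrier := {w | (∀ i, ContinuousOn (w i) (𝒯.macroCell i)) ∧
    ∀ K, IsPolyOn p (𝒯.cell K) (w (𝒯.owner K))}
  zero_mem' := ⟨fun _ => continuousOn_const, fun _ => IsPolyOn.zero _ _⟩
  add_mem' := fun ha hb => ⟨fun i => (ha.1 i).add (hb.1 i), fun K => (ha.2 K).add (hb.2 K)⟩
  smul_mem' := fun a _ hw =>
    ⟨fun i => (hw.1 i).const_smul a, fun K => (hw.2 K).smul a⟩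

/-- The space `ℳ_h` of traces on the interfaces of the macro-elements: polynomials of degree at
most `p` on each element face lying on an interface.  A trace is given as seen from each side;
it is single-valued, that is, the same (up to the periodic translation) from both sides. -/
def traceSpace (p : ℕ) : Submodule ℝ (𝒯.Side → Pt d → State d) where
  carrier := {μ | ∀ s, 𝒯.IsInterface s → IsPolyOn p (𝒯.facet s) (μ s) ∧
    ∀ x ∈ 𝒯.facet (𝒯.nbr s), μ s (𝒯.shift s + x) = μ (𝒯.nbr s) x}
  zero_mem' := fun _ _ => ⟨IsPolyOn.zero _ _, fun _ _ => rfl⟩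
  add_mem' := fun ha hb s hs => ⟨(ha s hs).1.add (hb s hs).1,
    fun x hx => by simp [(ha s hs).2 x hx, (hb s hs).2 x hx]⟩
  smul_mem' := fun a _ hw s hs => ⟨(hw s hs).1.smul a,
    fun x hx => by simp [(hw s hs).2 x hx]⟩

/-! ### The scheme -/

/-- `(v_h, v̂_h)` solves on `[0, T]` the semi-discrete entropy-variable macro-element HDG
discretization of the compressible Euler equations on the periodic domain, with trace space `M`
and numerical flux `Fhat s v̂ v n`. -/
structure IsSolution (γ T : ℝ) (p : ℕ) (M : Submodule ℝ (𝒯.Side → Pt d → State d))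
    (Fhat : 𝒯.Side → State d → State d → Pt d → State d)
    (v : ℝ → 𝒯.Macro → Pt d → State d) (vhat : ℝ → 𝒯.Side → Pt d → State d) : Prop where
  mem_volume : ∀ t ∈ Set.Icc 0 T, v t ∈ 𝒯.volumeSpace p
  mem_trace : ∀ t ∈ Set.Icc 0 T, vhat t ∈ M
  /-- The states are admissible, so that `u(v_h)` and the fluxes make sense. -/
  admissible_volume : ∀ t ∈ Set.Icc 0 T, ∀ i, ∀ x ∈ 𝒯.macroCell i, Admissible (v t i x)
  admissible_trace : ∀ t ∈ Set.Icc 0 T, ∀ s, 𝒯.IsInterface s → ∀ x ∈ 𝒯.facet s,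
    Admissible (vhat t s x)
  differentiable : ∀ i, ∀ x ∈ 𝒯.macroCell i, DifferentiableOn ℝ (fun t => v t i x) (Set.Icc 0 T)
  /-- `(∂ₜ u(v_h), w) - (F(v_h), ∇w) + ⟨F̂_h, w⟩ = 0`. -/
  volume_eq : ∀ t ∈ Set.Icc 0 T, ∀ w ∈ 𝒯.volumeSpace p,
    𝒯.volumeIntegral (fun K x =>
        derivWithin (fun τ => consVars γ (v τ (𝒯.owner K) x)) (Set.Icc 0 T) t ⬝ᵥ
          w (𝒯.owner K) x)
      - 𝒯.volumeIntegral (fun K x =>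
        ∑ j, eulerFlux γ (consVars γ (v t (𝒯.owner K) x)) j ⬝ᵥ
          fderivWithin ℝ (w (𝒯.owner K)) (𝒯.cell K) x (EuclideanSpace.single j 1))
      + 𝒯.boundaryIntegral (fun s x =>
        Fhat s (vhat t s x) (v t (𝒯.owner s.1) x) (𝒯.normal s) ⬝ᵥ w (𝒯.owner s.1) x) = 0
  /-- `⟨F̂_h, μ⟩ = 0`; a periodic domain has no boundary faces. -/
  trace_eq : ∀ t ∈ Set.Icc 0 T, ∀ μ ∈ M,
    𝒯.boundaryIntegral (fun s x =>
      Fhat s (vhat t s x) (v t (𝒯.owner s.1) x) (𝒯.normal s) ⬝ᵥ μ s x) = 0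

/-- Total generalized entropy `∫ H(u(v_h))`. -/
def totalEntropy (γ : ℝ) (v : 𝒯.Macro → Pt d → State d) : ℝ :=
  𝒯.volumeIntegral (fun K x => genEntropy γ (consVars γ (v (𝒯.owner K) x)))

end PeriodicMesh

/-! ### The maps `u ↦ v(u)` and `v ↦ u(v)` are mutually inverse -/

theorem density_consVars_pos (γ : ℝ) (v : State d) : 0 < density (consVars γ v) := by
  simpa [density, consVars] using Real.exp_pos _

theorem velocity_consVars (γ : ℝ) (v : State d) (i : Fin d) :
    velocity (consVars γ v) i = momC v i / -energyC v := by
  have h := (density_consVars_pos γ v).ne'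
  simp only [density, consVars, massC_mkState] at h
  simp only [velocity, consVars, momC_mkState, massC_mkState]
  field_simp

theorem pressure_consVars {γ : ℝ} (hγ : 1 < γ) (v : State d) :
    pressure γ (consVars γ v) = density (consVars γ v) / -energyC v := by
  have h : γ - 1 ≠ 0 := by linarith
  simp only [pressure, speedSq, velocity_consVars]
  simp only [density, consVars, massC_mkState, energyC_mkState, add_sub_cancel_right]
  rw [mul_div_cancel₀ _ h]

theorem physical_consVars {γ : ℝ} (hγ : 1 < γ) {v : State d} (hv : Admissible v) :
    Physical γ (consVars γ v) := by
  refine ⟨density_consVars_pos γ v, ?_⟩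
  rw [pressure_consVars hγ]
  exact div_pos (density_consVars_pos γ v) (by unfold Admissible at hv; linarith)

theorem betaOf_consVars {γ : ℝ} (hγ : 1 < γ) (v : State d) :
    betaOf γ (consVars γ v) = -energyC v := by
  have h := (density_consVars_pos γ v).ne'
  rw [betaOf, pressure_consVars hγ, div_div_cancel₀ h]

theorem specificEntropy_eq {γ : ℝ} {u : State d} (hu : Physical γ u) :
    specificEntropy γ u = -((γ - 1) * Real.log (density u)) - Real.log (betaOf γ u) := by
  obtain ⟨h1, h2⟩ := hu
  rw [specificEntropy, betaOf, Real.log_div h2.ne' (Real.rpow_pos_of_pos h1 γ).ne',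
    Real.log_rpow h1, Real.log_div h1.ne' h2.ne']
  ring

theorem entropyVars_consVars {γ : ℝ} (hγ : 1 < γ) {v : State d} (hv : Admissible v) :
    entropyVars γ (consVars γ v) = v := by
  have h : γ - 1 ≠ 0 := by linarith
  have hβ : -energyC v ≠ 0 := by unfold Admissible at hv; linarith
  have hs : specificEntropy γ (consVars γ v) = γ - (γ - 1) * (massC v +
      -energyC v * ((∑ i, (momC v i / -energyC v) ^ 2) / 2)) := by
    rw [specificEntropy_eq (physical_consVars hγ hv), betaOf_consVars hγ]
    simp only [density, consVars, massC_mkState, Real.log_exp]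
    field_simp
    ring
  rw [entropyVars, hs, betaOf_consVars hγ]
  conv_rhs => rw [← mkState_components v]
  congr 1
  · simp only [speedSq, velocity_consVars]
    field_simp
    ring
  · funext i
    rw [velocity_consVars, mul_div_cancel₀ _ hβ]
  · rw [neg_neg]

theorem consVars_entropyVars {γ : ℝ} (hγ : 1 < γ) {u : State d} (hu : Physical γ u) :
    consVars γ (entropyVars γ u) = u := by
  have h : γ - 1 ≠ 0 := by linarith
  obtain ⟨h1, h2⟩ := id hu
  have hβ : betaOf γ u ≠ 0 := (div_pos h1 h2).ne'
  have hV : ∀ i, momC (entropyVars γ u) i / betaOf γ u = velocity u i := fun i => by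
    rw [entropyVars, momC_mkState, mul_div_cancel_left₀ _ hβ]
  have hE : -energyC (entropyVars γ u) = betaOf γ u := by simp [entropyVars]
  have hρ : Real.exp (-((γ - (γ - 1) * (massC (entropyVars γ u) +
      betaOf γ u * ((∑ i, velocity u i ^ 2) / 2))) + Real.log (betaOf γ u)) / (γ - 1))
      = density u := by
    rw [entropyVars, massC_mkState, specificEntropy_eq hu, speedSq, sub_add_cancel,
      mul_div_cancel₀ _ h]
    conv_rhs => rw [← Real.exp_log h1]
    congr 1
    field_simp
    ring
  have hP : density u / betaOf γ u = pressure γ u := by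
    rw [betaOf, div_div_cancel₀ h1.ne']
  simp only [consVars, hE, hV, hρ, hP]
  conv_rhs => rw [← mkState_components u]
  congr 1
  · funext i
    simp only [velocity, density]
    rw [mul_div_cancel₀ _ (show massC u ≠ 0 from h1.ne')]
  · simp only [pressure, speedSq]
    rw [mul_div_cancel_left₀ _ h]
    ring

end EulerHDG

end

open EulerHDG

open EulerHDG

/-! Since `v_h` and `v̂_h` lie in their own test spaces, they may be used as `w` and `μ`. Because `v
= ∂H/∂u`, the time term then becomes `d/dt ∫ H`. The mass flux `ψ_j = ρ V_j` is a potential of the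
Euler flux, `F_j = ∂ψ_j/∂v`, so the volume term `(F, ∇v_h)` is the integral of a divergence and
equals `⟨ψ(v_h)·n, 1⟩` on the boundaries of the macro-elements. Two vanishing terms are added: `⟨F̂,
v̂_h⟩`, by the trace equation, and `⟨ψ(v̂_h)·n, 1⟩`, because `v̂_h` is single-valued while the two
normals of an interface are opposite. What remains is `d/dt ∫ H = ⟨F̂·⟦v⟧ - ⟦ψ⟧·n, 1⟩`.

The integrand is nonpositive at every point (`kepesFlux_dotProduct_le`). The averages in `F̄` are
chosen so that `F̄·⟦v⟧ = ⟦ψ⟧·n` exactly (`ecFlux_dotProduct`), and the remaining part of the flux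
subtracts a positive semidefinite quadratic form in `⟦v⟧`.

The analysis behind this has three parts. The divergence theorem on a simplex, with Hausdorff
measure on the facets, comes from Fubini along lines parallel to an edge
(`integral_fderiv_simplex`). The outward normals on a common facet are opposite because the
interiors of the simplices are disjoint (`outwardNormal_eq_neg`). The entropy integral is
differentiated through finitely many nodal values (`hasDerivWithinAt_integral_genEntropy`). -/

namespace EulerHDG

/-! ### Entropy variables: the potentials `ρ` and `ρV`, and the relation `dH = v · du`. -/

variable {d : ℕ}

theorem State.dotProduct_eq (u w : State d) :
    u ⬝ᵥ w = massC u * massC w + (∑ i, momC u i * momC w i + energyC u * energyC w) := by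
  simp [dotProduct, Fintype.sum_sum_type, massC, momC, energyC]

/-- The exponent is arranged as a constant, a multiple and a logarithm, the shape in which
`hasDerivWithinAt_density` assembles its derivative. -/
theorem density_consVars (γ : ℝ) (v : State d) :
    density (consVars γ v) = Real.exp (-γ / (γ - 1) * 1 + (γ - 1) / (γ - 1) * (massC v +
      (-energyC v) * ((∑ i, (momC v i / -energyC v) ^ 2) / 2)) -
        Real.log (-energyC v) / (γ - 1)) := by
  simp only [density, consVars, massC_mkState]
  congr 1
  ring

theorem energyC_consVars (γ : ℝ) (v : State d) :
    energyC (consVars γ v) = density (consVars γ v) / -energyC v / (γ - 1)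
      + density (consVars γ v) * (∑ i, (momC v i / -energyC v) ^ 2) / 2 := rfl

theorem momC_consVars (γ : ℝ) (v : State d) (i : Fin d) :
    momC (consVars γ v) i = density (consVars γ v) * (momC v i / -energyC v) := rfl

theorem massC_consVars (γ : ℝ) (v : State d) :
    massC (consVars γ v) = density (consVars γ v) := rfl

theorem isOpen_admissible : IsOpen {v : State d | Admissible v} :=
  isOpen_lt (by unfold energyC; fun_prop) continuous_const

theorem contDiffAt_density_consVars (γ : ℝ) {v : State d} (hv : Admissible v) :
    ContDiffAt ℝ ⊤ (fun v : State d => density (consVars γ v)) v := by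
  have hv' : -energyC v ≠ 0 := by unfold Admissible at hv; linarith
  simp only [density_consVars]
  unfold massC momC energyC at *
  fun_prop (disch := assumption)

theorem contDiffAt_consVars (γ : ℝ) {v : State d} (hv : Admissible v) :
    ContDiffAt ℝ ⊤ (consVars γ : State d → State d) v := by
  have hv' : -energyC v ≠ 0 := by unfold Admissible at hv; linarith
  have hr := contDiffAt_density_consVars γ hv
  rw [contDiffAt_pi]
  rintro (_ | i | _)
  · exact hr
  · change ContDiffAt ℝ ⊤ (fun v : State d => momC (consVars γ v) i) v
    simp only [momC_consVars]
    unfold momC energyC at *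
    fun_prop (disch := assumption)
  · change ContDiffAt ℝ ⊤ (fun v : State d => energyC (consVars γ v)) v
    simp only [energyC_consVars]
    unfold momC energyC at *
    fun_prop (disch := assumption)

/-- `H = v · u - ρ`: the entropy potential dual to `H` is the density. -/
theorem genEntropy_consVars {γ : ℝ} (hγ : 1 < γ) {v : State d} (hv : Admissible v) :
    genEntropy γ (consVars γ v) = v ⬝ᵥ consVars γ v - density (consVars γ v) := by
  have h : γ - 1 ≠ 0 := by linarith
  have hβ : -energyC v ≠ 0 := by unfold Admissible at hv; linarith
  have hβ' : energyC v ≠ 0 := by simpa using hβ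
  rw [genEntropy, specificEntropy_eq (physical_consVars hγ hv), betaOf_consVars hγ,
    State.dotProduct_eq, massC_consVars, energyC_consVars]
  simp only [momC_consVars]
  set r := density (consVars γ v) with hr
  have hlog : Real.log r = -γ / (γ - 1) * 1 + (γ - 1) / (γ - 1) * (massC v +
      (-energyC v) * ((∑ i, (momC v i / -energyC v) ^ 2) / 2)) -
        Real.log (-energyC v) / (γ - 1) := by
    rw [hr, density_consVars, Real.log_exp]
  rw [hlog]
  have e1 : ∑ i, momC v i * (r * (momC v i / -energyC v))
      = r * (-energyC v) * ∑ i, (momC v i / -energyC v) ^ 2 := by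
    rw [Finset.mul_sum]
    refine Finset.sum_congr rfl fun i _ => ?_
    field_simp
  rw [e1]
  generalize ∑ i, (momC v i / -energyC v) ^ 2 = S
  field_simp
  ring

/-- The formula `genEntropy_consVars` avoids the real power and the logarithm in `H`. It holds for
admissible `v` only, which suffices because these form an open set. -/
theorem contDiffAt_genEntropy_consVars {γ : ℝ} (hγ : 1 < γ) {v : State d} (hv : Admissible v) :
    ContDiffAt ℝ ⊤ (fun v : State d => genEntropy γ (consVars γ v)) v := by
  have h : ContDiffAt ℝ ⊤ (fun v : State d => v ⬝ᵥ consVars γ v - density (consVars γ v)) v := by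
    refine ContDiffAt.sub ?_ (contDiffAt_density_consVars γ hv)
    have h1 := contDiffAt_pi.1 (contDiffAt_consVars γ hv)
    unfold dotProduct
    exact ContDiffAt.sum fun i _ => ContDiffAt.mul (by fun_prop) (h1 i)
  refine h.congr_of_eventuallyEq ?_
  filter_upwards [isOpen_admissible.mem_nhds hv] with w hw
  exact genEntropy_consVars hγ hw

section Curves

variable {c : ℝ → State d} {c' : State d} {S : Set ℝ} {t : ℝ}

/-- `∂ρ/∂v = u`. -/
theorem hasDerivWithinAt_density {γ : ℝ} (hγ : 1 < γ) (hv : Admissible (c t))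
    (hc : HasDerivWithinAt c c' S t) :
    HasDerivWithinAt (fun τ => density (consVars γ (c τ))) (consVars γ (c t) ⬝ᵥ c') S t := by
  have h : γ - 1 ≠ 0 := by linarith
  have hβ : -energyC (c t) ≠ 0 := by unfold Admissible at hv; linarith
  have hβ' : energyC (c t) ≠ 0 := by simpa using hβ
  have hcomp := hasDerivWithinAt_pi.1 hc
  have h1 : HasDerivWithinAt (fun τ => massC (c τ)) (massC c') S t := hcomp _
  have h2 : ∀ i, HasDerivWithinAt (fun τ => momC (c τ) i) (momC c' i) S t := fun i => hcomp _
  have h3 : HasDerivWithinAt (fun τ => -energyC (c τ)) (-energyC c') S t := (hcomp _).neg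
  have hsq := HasDerivWithinAt.fun_sum (u := Finset.univ)
    fun i _ => ((h2 i).fun_div h3 hβ).fun_pow 2
  have key := ((((hasDerivWithinAt_const t S (-γ / (γ - 1) * 1)).add
    ((h1.add (h3.mul (hsq.div_const 2))).const_mul ((γ - 1) / (γ - 1)))).sub
      ((h3.log hβ).div_const (γ - 1)))).exp
  simp only [density_consVars]
  refine key.congr_deriv ?_
  rw [State.dotProduct_eq, massC_consVars, energyC_consVars]
  simp only [momC_consVars, density_consVars, Pi.add_apply, Pi.sub_apply, Pi.mul_apply]
  generalize Real.exp _ = r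
  rw [div_self h]
  -- The left side is the derivative of `|V|²` in the raw form given by the power and quotient
  -- rules.
  have e1 : ∑ i, (((2 : ℕ) : ℝ) * (momC (c t) i / -energyC (c t)) ^ (2 - 1) *
      ((momC c' i * -energyC (c t) - momC (c t) i * -energyC c') / (-energyC (c t)) ^ 2))
      = 2 / (-energyC (c t)) * ∑ i, momC (c t) i / -energyC (c t) * momC c' i
        + 2 * energyC c' / (-energyC (c t)) * ∑ i, (momC (c t) i / -energyC (c t)) ^ 2 := by
    rw [Finset.mul_sum, Finset.mul_sum, ← Finset.sum_add_distrib]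
    refine Finset.sum_congr rfl fun i _ => ?_
    norm_num
    field_simp
    ring
  have e2 : ∑ i, r * (momC (c t) i / -energyC (c t)) * momC c' i
      = r * ∑ i, momC (c t) i / -energyC (c t) * momC c' i := by
    rw [Finset.mul_sum]
    exact Finset.sum_congr rfl fun i _ => by ring
  rw [e2]
  rw [e1]
  generalize ∑ i, momC (c t) i / -energyC (c t) * momC c' i = A
  generalize ∑ i, (momC (c t) i / -energyC (c t)) ^ 2 = B
  field_simp
  ring

/-- `∂(ρ Vⱼ)/∂v = Fⱼ`: the entropy flux potential. -/
theorem hasDerivWithinAt_massFlux {γ : ℝ} (hγ : 1 < γ) (hv : Admissible (c t))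
    (hc : HasDerivWithinAt c c' S t) (j : Fin d) :
    HasDerivWithinAt (fun τ => momC (consVars γ (c τ)) j)
      (eulerFlux γ (consVars γ (c t)) j ⬝ᵥ c') S t := by
  have h : γ - 1 ≠ 0 := by linarith
  have hβ : -energyC (c t) ≠ 0 := by unfold Admissible at hv; linarith
  have hβ' : energyC (c t) ≠ 0 := by simpa using hβ
  have hcomp := hasDerivWithinAt_pi.1 hc
  have h2 : ∀ i, HasDerivWithinAt (fun τ => momC (c τ) i) (momC c' i) S t := fun i => hcomp _
  have h3 : HasDerivWithinAt (fun τ => -energyC (c τ)) (-energyC c') S t := (hcomp _).neg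
  simp only [momC_consVars]
  -- The product rule for `ρ · V_j` reuses `∂ρ/∂v = u`; differentiating `V_j = m_j / β` produces the
  -- pressure terms through `P = ρ / β`.
  refine ((hasDerivWithinAt_density hγ hv hc).mul ((h2 j).fun_div h3 hβ)).congr_deriv ?_
  rw [State.dotProduct_eq, State.dotProduct_eq, massC_consVars, energyC_consVars]
  simp only [momC_consVars, eulerFlux, massC_mkState, momC_mkState, energyC_mkState,
    velocity_consVars, pressure_consVars hγ, energyC_consVars]
  generalize density (consVars γ (c t)) = r
  simp only [add_mul, ite_mul, zero_mul, Finset.sum_add_distrib, Finset.sum_ite_eq',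
    Finset.mem_univ, if_true]
  have e3 : ∑ i, r * (momC (c t) i / -energyC (c t)) * (momC (c t) j / -energyC (c t)) * momC c' i
      = (momC (c t) j / -energyC (c t)) *
        ∑ i, r * (momC (c t) i / -energyC (c t)) * momC c' i := by
    rw [Finset.mul_sum]
    exact Finset.sum_congr rfl fun i _ => by ring
  rw [e3]
  generalize ∑ i, r * (momC (c t) i / -energyC (c t)) * momC c' i = A
  generalize ∑ i, (momC (c t) i / -energyC (c t)) ^ 2 = B
  field_simp
  ring

/-- `dH = v · du`. -/
theorem hasDerivWithinAt_genEntropy {γ : ℝ} (hγ : 1 < γ) (hv : ∀ τ ∈ S, Admissible (c τ))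
    (ht : t ∈ S) (hc : HasDerivWithinAt c c' S t) :
    HasDerivWithinAt (fun τ => genEntropy γ (consVars γ (c τ)))
      (derivWithin (fun τ => consVars γ (c τ)) S t ⬝ᵥ c t) S t := by
  have hu : HasDerivWithinAt (fun τ => consVars γ (c τ))
      (derivWithin (fun τ => consVars γ (c τ)) S t) S t := by
    refine DifferentiableWithinAt.hasDerivWithinAt ?_
    exact ((contDiffAt_consVars γ (hv t ht)).differentiableAt (by simp)).comp_differentiableWithinAt
      t hc.differentiableWithinAt
  have h1 := hasDerivWithinAt_pi.1 hc
  have h2 := hasDerivWithinAt_pi.1 hu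
  have h3 : HasDerivWithinAt (fun τ => c τ ⬝ᵥ consVars γ (c τ))
      (c' ⬝ᵥ consVars γ (c t) + c t ⬝ᵥ derivWithin (fun τ => consVars γ (c τ)) S t) S t := by
    have := HasDerivWithinAt.fun_sum (u := Finset.univ) fun k _ => (h1 k).fun_mul (h2 k)
    refine this.congr_deriv ?_
    simp [dotProduct, Finset.sum_add_distrib]
  -- In `d(v · u - ρ) = v · du + u · dv - dρ` the last two terms cancel, by `∂ρ/∂v = u`.
  refine ((h3.sub (hasDerivWithinAt_density hγ (hv t ht) hc)).congr ?_ ?_).congr_deriv ?_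
  · intro τ hτ
    exact genEntropy_consVars hγ (hv τ hτ)
  · exact genEntropy_consVars hγ (hv t ht)
  · rw [dotProduct_comm c', dotProduct_comm (c t)]
    ring

end Curves

end EulerHDG

/-! ### Logarithmic means and the pointwise entropy inequality of the flux. -/

namespace EulerHDG

variable {d : ℕ}

/-- With `x = ln (b / a)` the mean is `a (eˣ - 1) / x`. Its singularity at `x = 0` is removable, and
`dslope` fills it in, so the mean is continuous across `a = b`. -/
theorem logMean_eq_mul_dslope {a b : ℝ} (ha : 0 < a) (hb : 0 < b) :
    logMean a b = a * dslope Real.exp 0 (Real.log (b / a)) := by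
  unfold logMean
  split_ifs with h
  · subst h
    rw [div_self ha.ne', Real.log_one, dslope_same, Real.deriv_exp, Real.exp_zero, mul_one]
  · have hne : Real.log (b / a) ≠ 0 := by
      rw [Real.log_div hb.ne' ha.ne', sub_ne_zero]
      exact fun h' => h (Real.log_injOn_pos ha hb h'.symm)
    rw [dslope_of_ne _ hne, slope_def_field, Real.exp_zero, Real.exp_log (div_pos hb ha), sub_zero,
      ← mul_div_assoc, mul_sub, mul_one, mul_div_cancel₀ _ ha.ne']

theorem logMean_pos {a b : ℝ} (ha : 0 < a) (hb : 0 < b) : 0 < logMean a b := by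
  unfold logMean
  split_ifs with h
  · exact ha
  · rw [Real.log_div hb.ne' ha.ne']
    rcases lt_or_gt_of_ne h with h | h
    · exact div_pos (sub_pos.2 h) (sub_pos.2 (Real.log_lt_log ha h))
    · exact div_pos_of_neg_of_neg (sub_neg.2 h) (sub_neg.2 (Real.log_lt_log hb h))

/-- A discrete chain rule for the logarithm, valid also for `a = b`. It is what entropy conservation
requires of the logarithmic mean. -/
theorem logMean_mul_log_sub {a b : ℝ} (ha : 0 < a) (hb : 0 < b) :
    logMean a b * (Real.log b - Real.log a) = b - a := by
  unfold logMean
  split_ifs with h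
  · simp [h]
  · rw [← Real.log_div hb.ne' ha.ne', div_mul_cancel₀]
    rw [Real.log_div hb.ne' ha.ne', sub_ne_zero]
    exact fun h' => h (Real.log_injOn_pos ha hb h'.symm)

theorem continuous_dslope_exp : Continuous (dslope Real.exp 0) := by
  rw [continuous_iff_continuousAt]
  intro x
  rcases eq_or_ne x 0 with rfl | h
  · exact continuousAt_dslope_same.2 Real.differentiableAt_exp
  · exact (continuousAt_dslope_of_ne h).2 Real.continuous_exp.continuousAt

theorem ContinuousOn.logMean {X : Type*} [TopologicalSpace X] {f g : X → ℝ} {s : Set X}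
    (hf : ContinuousOn f s) (hg : ContinuousOn g s) (hf' : ∀ x ∈ s, 0 < f x)
    (hg' : ∀ x ∈ s, 0 < g x) : ContinuousOn (fun x => EulerHDG.logMean (f x) (g x)) s := by
  refine ContinuousOn.congr (f := fun x => f x * dslope Real.exp 0 (Real.log (g x / f x))) ?_
    fun x hx => logMean_eq_mul_dslope (hf' x hx) (hg' x hx)
  refine hf.mul (continuous_dslope_exp.comp_continuousOn ?_)
  exact ((hg.div hf fun x hx => (hf' x hx).ne').log fun x hx =>
    (div_pos (hg' x hx) (hf' x hx)).ne')

section Means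

variable {γ : ℝ} {vh v : State d}

theorem betaOf_consVars_pos (hγ : 1 < γ) (hv : Admissible v) : 0 < betaOf γ (consVars γ v) := by
  rw [betaOf_consVars hγ]
  unfold Admissible at hv
  linarith

theorem amean_pos {a b : ℝ} (ha : 0 < a) (hb : 0 < b) : 0 < amean a b := by
  unfold amean
  linarith

theorem rhoLn_pos : 0 < rhoLn γ vh v :=
  logMean_pos (density_consVars_pos _ _) (density_consVars_pos _ _)

theorem betaLn_pos (hγ : 1 < γ) (hvh : Admissible vh) (hv : Admissible v) : 0 < betaLn γ vh v :=
  logMean_pos (betaOf_consVars_pos hγ hv) (betaOf_consVars_pos hγ hvh)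

theorem betaMean_pos (hγ : 1 < γ) (hvh : Admissible vh) (hv : Admissible v) :
    0 < betaMean γ vh v :=
  amean_pos (betaOf_consVars_pos hγ hv) (betaOf_consVars_pos hγ hvh)

theorem rhoMean_pos : 0 < rhoMean γ vh v :=
  amean_pos (density_consVars_pos _ _) (density_consVars_pos _ _)

theorem pMean_pos (hγ : 1 < γ) (hvh : Admissible vh) (hv : Admissible v) : 0 < pMean γ vh v :=
  div_pos rhoMean_pos (betaMean_pos hγ hvh hv)

/-- For positive pressures `|P - P̂| ≤ P + P̂`. This keeps the weight `1 - θ` of the hybrid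
eigenvalues nonnegative. -/
theorem theta_le_one (hγ : 1 < γ) (hvh : Admissible vh) (hv : Admissible v) :
    theta γ vh v ≤ 1 := by
  have h1 := (physical_consVars hγ hv).2
  have h2 := (physical_consVars hγ hvh).2
  rw [theta, Real.sqrt_le_left (by norm_num), one_pow, abs_div, abs_of_pos (add_pos h1 h2),
    div_le_one (add_pos h1 h2), abs_le]
  constructor <;> linarith

/-- The jump of the first entropy variable thus consists of jumps of `log ρ` and `log β`, which the
logarithmic means turn into jumps of `ρ` and `β`, and of a kinetic part. -/
theorem log_density_consVars (hγ : 1 < γ) (v : State d) :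
    massC v = Real.log (density (consVars γ v)) + Real.log (-energyC v) / (γ - 1)
      + γ / (γ - 1) - (-energyC v) * ((∑ i, (momC v i / -energyC v) ^ 2) / 2) := by
  have h : γ - 1 ≠ 0 := by linarith
  rw [density_consVars, Real.log_exp]
  field_simp
  ring

/-- Tadmor's condition: the flux `F̄` is entropy conservative. -/
theorem ecFlux_dotProduct (hγ : 1 < γ) (hvh : Admissible vh) (hv : Admissible v) (n : Pt d) :
    ecFlux γ vh v n ⬝ᵥ (vh - v) =
      ∑ i, momC (consVars γ vh) i * n i - ∑ i, momC (consVars γ v) i * n i := by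
  have h : γ - 1 ≠ 0 := by linarith
  have hb : 0 < -energyC v := by unfold Admissible at hv; linarith
  have hbh : 0 < -energyC vh := by unfold Admissible at hvh; linarith
  have hbL := (betaLn_pos hγ hvh hv).ne'
  have hbM := (betaMean_pos hγ hvh hv).ne'
  have lr : rhoLn γ vh v * (Real.log (density (consVars γ vh)) - Real.log (density (consVars γ v)))
      = density (consVars γ vh) - density (consVars γ v) :=
    logMean_mul_log_sub (density_consVars_pos _ _) (density_consVars_pos _ _)
  have lb : betaLn γ vh v * (Real.log (-energyC vh) - Real.log (-energyC v))
      = -energyC vh - -energyC v := by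
    rw [betaLn, betaOf_consVars hγ, betaOf_consVars hγ]
    exact logMean_mul_log_sub hb hbh
  have hbeta : betaMean γ vh v = (-energyC v + -energyC vh) / 2 := by
    rw [betaMean, betaOf_consVars hγ, betaOf_consVars hγ, amean]
  have hP : pMean γ vh v * betaMean γ vh v
      = (density (consVars γ v) + density (consVars γ vh)) / 2 := by
    rw [pMean, div_mul_cancel₀ _ hbM, rhoMean, amean]
  have hV : ∀ i, velMean γ vh v i = (momC v i / -energyC v + momC vh i / -energyC vh) / 2 := by
    intro i
    rw [velMean, velocity_consVars, velocity_consVars, amean]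
  have hS : speedSqMean γ vh v = (∑ i, (momC v i / -energyC v) ^ 2
      + ∑ i, (momC vh i / -energyC vh) ^ 2) / 2 := by
    simp only [speedSqMean, amean, speedSq, velocity_consVars]
  have hm : massC (vh - v) = massC vh - massC v := rfl
  have he : energyC (vh - v) = energyC vh - energyC v := rfl
  have hmom : ∀ i, momC (vh - v) i = -energyC vh * (momC vh i / -energyC vh)
      - -energyC v * (momC v i / -energyC v) := fun i => by
    rw [mul_div_cancel₀ _ hb.ne', mul_div_cancel₀ _ hbh.ne']; rfl
  rw [State.dotProduct_eq, hm, he, log_density_consVars hγ v, log_density_consVars hγ vh]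
  simp only [ecFlux, massC_mkState, momC_mkState, energyC_mkState, momC_consVars, hmom]
  have hnum : velMeanDot γ vh v n = ∑ i, (momC v i / -energyC v + momC vh i / -energyC vh) / 2
      * n i := by
    simp only [velMeanDot, hV]
  simp only [hV, hS]
  have hev : energyC vh - energyC v = -energyC v - -energyC vh := by ring
  rw [hev]
  generalize -energyC vh = bh at *
  generalize -energyC v = b at *
  rw [hnum]
  generalize hVdef : (fun i => momC v i / b) = V
  generalize hWdef : (fun i => momC vh i / bh) = W
  have hV' : ∀ i, momC v i / b = V i := fun i => congrFun hVdef i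
  have hW' : ∀ i, momC vh i / bh = W i := fun i => congrFun hWdef i
  simp only [hV', hW']
  generalize density (consVars γ v) = r at *
  generalize density (consVars γ vh) = rh at *
  generalize rhoLn γ vh v = L at *
  generalize betaLn γ vh v = B at *
  generalize pMean γ vh v = P at *
  -- All sums over components are reduced to the five scalars `V·n`, `W·n`, `|V|²`, `|W|²` and
  -- `V·W`, so that a scalar identity remains.
  have s1 : ∑ i, (V i + W i) / 2 * n i = (∑ i, V i * n i + ∑ i, W i * n i) / 2 := by
    rw [← Finset.sum_add_distrib, Finset.sum_div]
    exact Finset.sum_congr rfl fun i _ => by ring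
  rw [s1]
  have s2 : ∀ f : ℝ, ∑ i, ((V i + W i) / 2 * f + P * n i) * (bh * W i - b * V i)
      = f / 2 * (bh * ∑ i, W i ^ 2 - b * ∑ i, V i ^ 2 + (bh - b) * ∑ i, V i * W i)
        + P * (bh * ∑ i, W i * n i - b * ∑ i, V i * n i) := by
    intro f
    simp only [Finset.mul_sum, ← Finset.sum_add_distrib, ← Finset.sum_sub_distrib]
    exact Finset.sum_congr rfl fun i _ => by ring
  have s3 : ∀ f : ℝ, ∑ i, (V i + W i) / 2 * ((V i + W i) / 2 * f + P * n i)
      = f / 4 * (∑ i, V i ^ 2 + 2 * ∑ i, V i * W i + ∑ i, W i ^ 2)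
        + P / 2 * (∑ i, V i * n i + ∑ i, W i * n i) := by
    intro f
    simp only [Finset.mul_sum, ← Finset.sum_add_distrib]
    exact Finset.sum_congr rfl fun i _ => by ring
  have s4 : ∀ x : ℝ, ∀ Y : Fin d → ℝ, ∑ i, x * Y i * n i = x * ∑ i, Y i * n i := by
    intro x Y
    simp only [Finset.mul_sum]
    exact Finset.sum_congr rfl fun i _ => by ring
  rw [s2, s3, s4, s4]
  rw [hbeta] at hP
  generalize ∑ i, V i * n i = Vn at *
  generalize ∑ i, W i * n i = Wn at *
  generalize ∑ i, V i ^ 2 = SV at *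
  generalize ∑ i, W i ^ 2 = SW at *
  generalize ∑ i, V i * W i = VW at *
  generalize Real.log r = lr1 at *
  generalize Real.log rh = lr2 at *
  have hbb : b - bh = -(B * (Real.log bh - Real.log b)) := by rw [lb]; ring
  have hq : 1 / (B * (γ - 1)) * (b - bh) = -(Real.log bh - Real.log b) / (γ - 1) := by
    rw [hbb]
    field_simp
  generalize Real.log b = lb1 at *
  generalize Real.log bh = lb2 at *
  -- The target `⟦ρ Vₙ⟧` is the jump of `ρ` times the mean of `Vₙ`, given by `lr`, plus the mean of
  -- `ρ` times the jump of `Vₙ`, given by `hP`, that is by `P̄ β̄ = ρ̄`. The relation `hq` cancels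
  -- the jump of `log β` against the internal energy part of `f₃`.
  linear_combination ((Vn + Wn) / 2) * lr + (Wn - Vn) * hP + L * ((Vn + Wn) / 2) * hq

theorem hybridEigenvalues_nonneg (hγ : 1 < γ) (hvh : Admissible vh) (hv : Admissible v)
    (lam : ℝ) (n : Pt d) (k : Comp d) : 0 ≤ hybridEigenvalues γ vh v lam n k :=
  add_nonneg (mul_nonneg (sub_nonneg.2 (theta_le_one hγ hvh hv)) (abs_nonneg _))
    (mul_nonneg (Real.sqrt_nonneg _) (abs_nonneg _))

theorem scaling_nonneg [NeZero d] (hγ : 1 < γ) (hvh : Admissible vh) (hv : Admissible v)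
    (k : Comp d) : 0 ≤ scaling γ vh v k := by
  have h0 : 0 < γ := by linarith
  have h1 : 0 < γ - 1 := by linarith
  have h2 : 0 < rhoLn γ vh v := rhoLn_pos
  have h3 := pMean_pos hγ hvh hv
  rcases k with _ | k | _
  · change 0 ≤ rhoLn γ vh v / (2 * γ)
    positivity
  · change 0 ≤ if k = 0 then rhoLn γ vh v * (γ - 1) / γ else pMean γ vh v
    split_ifs <;> positivity
  · change 0 ≤ rhoLn γ vh v / (2 * γ)
    positivity

/-- The quadratic form is `∑ Dᵢ Sᵢ (Rᵗ x)ᵢ²`. -/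
theorem dotProduct_mul_diagonal_mulVec_nonneg {m k : Type*} [Fintype m] [Fintype k] [DecidableEq k]
    (R : Matrix m k ℝ) {D S : k → ℝ} (hD : ∀ i, 0 ≤ D i) (hS : ∀ i, 0 ≤ S i) (x : m → ℝ) :
    0 ≤ ((R * Matrix.diagonal D * Matrix.diagonal S * Rᵀ) *ᵥ x) ⬝ᵥ x := by
  rw [← Matrix.mulVec_mulVec, Matrix.mul_assoc, Matrix.diagonal_mul_diagonal,
    ← Matrix.mulVec_mulVec, dotProduct_comm, Matrix.dotProduct_mulVec, ← Matrix.mulVec_transpose]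
  refine Finset.sum_nonneg fun i _ => ?_
  rw [Matrix.mulVec_diagonal]
  nlinarith [mul_nonneg (mul_nonneg (hD i) (hS i)) (mul_self_nonneg ((Rᵀ *ᵥ x) i))]

/-- The flux `F̂` is entropy stable. -/
theorem kepesFlux_dotProduct_le [NeZero d] (hγ : 1 < γ) (hvh : Admissible vh) (hv : Admissible v)
    (lam : ℝ) (E : OrthonormalBasis (Fin d) ℝ (Pt d)) (n : Pt d) :
    kepesFlux γ vh v lam E n ⬝ᵥ (vh - v) ≤
      ∑ i, momC (consVars γ vh) i * n i - ∑ i, momC (consVars γ v) i * n i := by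
  rw [kepesFlux, sub_dotProduct, ecFlux_dotProduct hγ hvh hv, smul_dotProduct, smul_eq_mul]
  have := dotProduct_mul_diagonal_mulVec_nonneg (eigMatrix γ vh v E)
    (hybridEigenvalues_nonneg hγ hvh hv lam n) (scaling_nonneg hγ hvh hv) (vh - v)
  linarith

end Means

/-! ### Continuity of the numerical flux in the two states. -/

section Continuity

variable {γ : ℝ}

theorem continuousOn_consVars :
    ContinuousOn (consVars γ : State d → State d) {v | Admissible v} := fun _ hv =>
  (contDiffAt_consVars γ hv).continuousAt.continuousWithinAt

variable {X : Type*} [TopologicalSpace X] {s : Set X} {a b : X → State d}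

theorem continuousOn_density (ha : ContinuousOn a s) (ha' : ∀ x ∈ s, Admissible (a x)) :
    ContinuousOn (fun x => density (consVars γ (a x))) s :=
  continuousOn_pi.1 (continuousOn_consVars.comp ha ha') (Sum.inl ())

theorem continuousOn_momC (ha : ContinuousOn a s) (ha' : ∀ x ∈ s, Admissible (a x)) (i : Fin d) :
    ContinuousOn (fun x => momC (consVars γ (a x)) i) s :=
  continuousOn_pi.1 (continuousOn_consVars.comp ha ha') (Sum.inr (Sum.inl i))

theorem continuousOn_velocity (ha : ContinuousOn a s) (ha' : ∀ x ∈ s, Admissible (a x))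
    (i : Fin d) : ContinuousOn (fun x => velocity (consVars γ (a x)) i) s :=
  (continuousOn_momC ha ha' i).div (continuousOn_density ha ha')
    fun _ _ => (density_consVars_pos γ _).ne'

theorem continuousOn_speedSq (ha : ContinuousOn a s) (ha' : ∀ x ∈ s, Admissible (a x)) :
    ContinuousOn (fun x => speedSq (consVars γ (a x))) s :=
  continuousOn_finsetSum _ fun i _ => (continuousOn_velocity ha ha' i).pow 2

theorem continuousOn_pressure (ha : ContinuousOn a s) (ha' : ∀ x ∈ s, Admissible (a x)) :
    ContinuousOn (fun x => pressure γ (consVars γ (a x))) s := by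
  have h1 : ContinuousOn (fun x => energyC (consVars γ (a x))) s :=
    continuousOn_pi.1 (continuousOn_consVars.comp ha ha') (Sum.inr (Sum.inr ()))
  exact continuousOn_const.mul
    (h1.sub (((continuousOn_density ha ha').mul (continuousOn_speedSq ha ha')).div_const _))

theorem continuousOn_betaOf (hγ : 1 < γ) (ha : ContinuousOn a s)
    (ha' : ∀ x ∈ s, Admissible (a x)) :
    ContinuousOn (fun x => betaOf γ (consVars γ (a x))) s :=
  (continuousOn_density ha ha').div (continuousOn_pressure ha ha')
    fun x hx => (physical_consVars hγ (ha' x hx)).2.ne'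

theorem continuousOn_mkState {f h : X → ℝ} {g : X → Fin d → ℝ} (hf : ContinuousOn f s)
    (hg : ∀ i, ContinuousOn (fun x => g x i) s) (hh : ContinuousOn h s) :
    ContinuousOn (fun x => mkState (f x) (g x) (h x)) s := by
  rw [continuousOn_pi]
  rintro (_ | i | _)
  exacts [hf, hg i, hh]

/-- This makes the boundary terms integrable, without which the pointwise inequality could not be
integrated. The choice of `λ_max` enters here: the pointwise inequality holds for any number `lam`,
whereas continuity uses the form of `lam`. -/
theorem continuousOn_kepesFlux [NeZero d] (hγ : 1 < γ) (ha : ContinuousOn a s)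
    (ha' : ∀ x ∈ s, Admissible (a x)) (hb : ContinuousOn b s) (hb' : ∀ x ∈ s, Admissible (b x))
    {lam : State d → State d → Pt d → ℝ}
    (hlam : lam = (fun vh _ n => lamMaxTrace γ vh n) ∨ lam = lamMaxMean γ)
    (E : OrthonormalBasis (Fin d) ℝ (Pt d)) (n : Pt d) :
    ContinuousOn (fun x => kepesFlux γ (a x) (b x) (lam (a x) (b x) n) E n) s := by
  have hγ0 : γ - 1 ≠ 0 := by linarith
  have dA := continuousOn_density (γ := γ) ha ha'
  have dB := continuousOn_density (γ := γ) hb hb'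
  have pA := continuousOn_pressure (γ := γ) ha ha'
  have pB := continuousOn_pressure (γ := γ) hb hb'
  have bA := continuousOn_betaOf hγ ha ha'
  have bB := continuousOn_betaOf hγ hb hb'
  have vA := continuousOn_velocity (γ := γ) ha ha'
  have vB := continuousOn_velocity (γ := γ) hb hb'
  have hr : ContinuousOn (fun x => rhoLn γ (a x) (b x)) s :=
    dB.logMean dA (fun _ _ => density_consVars_pos _ _) (fun _ _ => density_consVars_pos _ _)
  have hβ : ContinuousOn (fun x => betaLn γ (a x) (b x)) s :=
    bB.logMean bA (fun x hx => betaOf_consVars_pos hγ (hb' x hx))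
      (fun x hx => betaOf_consVars_pos hγ (ha' x hx))
  have hβ0 : ∀ x ∈ s, betaLn γ (a x) (b x) * (γ - 1) ≠ 0 := fun x hx =>
    mul_ne_zero (betaLn_pos hγ (ha' x hx) (hb' x hx)).ne' hγ0
  have hP : ContinuousOn (fun x => pMean γ (a x) (b x)) s :=
    ((dB.add dA).div_const 2).div ((bB.add bA).div_const 2)
      fun x hx => (betaMean_pos hγ (ha' x hx) (hb' x hx)).ne'
  have hV : ∀ i, ContinuousOn (fun x => velMean γ (a x) (b x) i) s := fun i =>
    ((vB i).add (vA i)).div_const 2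
  have hVd : ∀ e : Pt d, ContinuousOn (fun x => velMeanDot γ (a x) (b x) e) s := fun e =>
    continuousOn_finsetSum _ fun i _ => (hV i).mul continuousOn_const
  have hS : ContinuousOn (fun x => speedSqMean γ (a x) (b x)) s :=
    ((continuousOn_speedSq hb hb').add (continuousOn_speedSq ha ha')).div_const 2
  have hc : ContinuousOn (fun x => cMean γ (a x) (b x)) s :=
    ((continuousOn_const.mul hP).div hr fun _ _ => rhoLn_pos.ne').sqrt
  have hh : ContinuousOn (fun x => hMean γ (a x) (b x)) s :=
    (continuousOn_const.div (hβ.mul continuousOn_const) hβ0).add (hS.div_const 2)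
  have hθ : ContinuousOn (fun x => theta γ (a x) (b x)) s :=
    ((pB.sub pA).div (pB.add pA) fun x hx => (add_pos (physical_consVars hγ (hb' x hx)).2
      (physical_consVars hγ (ha' x hx)).2).ne').abs.sqrt
  have hl : ContinuousOn (fun x => lam (a x) (b x) n) s := by
    rcases hlam with rfl | rfl
    · exact (continuousOn_finsetSum _ fun i _ => (vA i).mul continuousOn_const).add
        ((continuousOn_const.mul pA).div dA fun _ _ => (density_consVars_pos _ _).ne').sqrt
    · exact (hVd n).add hc
  have hf₁ := hr.mul (hVd n)
  have hf₂ := fun i => ((hV i).mul hf₁).add (hP.mul (continuousOn_const (c := n i)))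
  have hec : ContinuousOn (fun x => ecFlux γ (a x) (b x) n) s := by
    refine continuousOn_mkState hf₁ hf₂ ?_
    exact (((continuousOn_const.div (hβ.mul continuousOn_const) hβ0).sub (hS.div_const 2)).mul
      hf₁).add (continuousOn_finsetSum _ fun i _ => (hV i).mul (hf₂ i))
  have hR : ∀ r k, ContinuousOn (fun x => eigMatrix γ (a x) (b x) E r k) s := by
    intro r k
    rcases k with _ | k | _
    · exact continuousOn_pi.1 (continuousOn_mkState continuousOn_const
        (fun i => (hV i).sub (hc.mul continuousOn_const)) (hh.sub ((hVd _).mul hc))) r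
    · by_cases hk : k = 0
      · simp only [eigMatrix, Matrix.of_apply, hk, if_true]
        exact continuousOn_pi.1 (continuousOn_mkState continuousOn_const hV (hS.div_const 2)) r
      · simp only [eigMatrix, Matrix.of_apply, hk, if_false]
        exact continuousOn_pi.1 (continuousOn_mkState (g := fun _ i => E k i) continuousOn_const
          (fun i => continuousOn_const) (hVd (E k))) r
    · exact continuousOn_pi.1 (continuousOn_mkState continuousOn_const
        (fun i => (hV i).add (hc.mul continuousOn_const)) (hh.add ((hVd _).mul hc))) r
  have hΛ : ∀ k, ContinuousOn
      (fun x => hybridEigenvalues γ (a x) (b x) (lam (a x) (b x) n) n k) s := fun k =>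
    ((continuousOn_const.sub hθ).mul (continuousOn_pi.1 (continuousOn_mkState ((hVd n).add hc)
      (fun _ => hVd n) ((hVd n).add hc)) k).abs).add (hθ.mul hl.abs)
  have hT : ∀ k, ContinuousOn (fun x => scaling γ (a x) (b x) k) s := by
    intro k
    refine continuousOn_pi.1 (continuousOn_mkState (hr.div_const _) (fun i => ?_)
      (hr.div_const _)) k
    by_cases hi : i = 0
    · simp only [hi, if_true]
      exact (hr.mul continuousOn_const).div_const _
    · simpa only [hi, if_false] using hP
  rw [continuousOn_pi] at hec ha hb ⊢
  intro r
  refine (hec r).sub (continuousOn_const.smul ?_)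
  simp only [Matrix.mulVec, dotProduct]
  refine continuousOn_finsetSum _ fun k _ => ContinuousOn.mul ?_ ((ha k).sub (hb k))
  have hM : ∀ (R : Matrix (Comp d) (Comp d) ℝ) (D S : State d),
      (R * Matrix.diagonal D * Matrix.diagonal S * Rᵀ) r k = ∑ l, R r l * D l * S l * R k l := by
    intro R D S
    rw [Matrix.mul_apply]
    simp only [Matrix.mul_diagonal, Matrix.transpose_apply]
  simp only [hM]
  exact continuousOn_finsetSum _ fun l _ => (((hR r l).mul (hΛ l)).mul (hT l)).mul (hR k l)

end Continuity

end EulerHDG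

namespace EulerHDG

variable {d : ℕ}

/-! ### Barycentric coordinates, facets and normals of a simplex. -/

section Barycentric

variable (S : Affine.Simplex ℝ (Pt d) d)

/-- The vertices of a full-dimensional simplex as an affine basis. -/
noncomputable def simplexBasis : AffineBasis (Fin (d + 1)) ℝ (Pt d) :=
  ⟨S.points, S.independent, by
    rw [S.independent.affineSpan_eq_top_iff_card_eq_finrank_add_one]
    simp⟩

/-- Barycentric coordinates. -/
noncomputable def bary (k : Fin (d + 1)) : Pt d →ᵃ[ℝ] ℝ := (simplexBasis S).coord k

variable {S}

theorem bary_point (k l : Fin (d + 1)) : bary S k (S.points l) = if k = l then 1 else 0 :=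
  (simplexBasis S).coord_apply k l

theorem continuous_bary (k : Fin (d + 1)) : Continuous (bary S k) :=
  (bary S k).continuous_of_finiteDimensional

theorem sum_bary (x : Pt d) : ∑ k, bary S k x = 1 := (simplexBasis S).sum_coord_apply_eq_one x

theorem affineCombination_bary (x : Pt d) :
    Finset.univ.affineCombination ℝ S.points (fun k => bary S k x) = x :=
  (simplexBasis S).affineCombination_coord_eq_self x

theorem bary_add (k : Fin (d + 1)) (x w : Pt d) :
    bary S k (x + w) = bary S k x + (bary S k).linear w := by
  have := (bary S k).map_vadd x w
  rw [vadd_eq_add, vadd_eq_add, add_comm] at this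
  rw [this, add_comm]

theorem bary_linear_sub (k i j : Fin (d + 1)) :
    (bary S k).linear (S.points i - S.points j) =
      (if k = i then 1 else 0) - (if k = j then 1 else 0) := by
  have := (bary S k).linearMap_vsub (S.points i) (S.points j)
  rw [vsub_eq_sub, vsub_eq_sub] at this
  rw [this, bary_point, bary_point]

/-- The upper bounds on the weights follow from nonnegativity and the sum being 1. -/
theorem mem_closedInterior_iff {x : Pt d} : x ∈ S.closedInterior ↔ ∀ k, 0 ≤ bary S k x := by
  have h := Affine.Simplex.affineCombination_mem_closedInterior_iff (s := S) (sum_bary (S := S) x)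
  rw [affineCombination_bary] at h
  rw [h]
  refine ⟨fun h k => (h k).1, fun h k => ⟨h k, ?_⟩⟩
  rw [← sum_bary (S := S) x]
  exact Finset.single_le_sum (fun t _ => h t) (Finset.mem_univ k)

theorem mem_facet_iff [NeZero d] {i : Fin (d + 1)} {x : Pt d} :
    x ∈ (S.faceOpposite i).closedInterior ↔ bary S i x = 0 ∧ ∀ k, 0 ≤ bary S k x := by
  have h := S.affineCombination_mem_closedInterior_face_iff_nonneg
    (fs := {i}ᶜ) (m := d - 1) (by
      have := NeZero.pos d
      rw [Finset.card_compl, Finset.card_singleton, Fintype.card_fin]; omega) (sum_bary (S := S) x)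
  rw [affineCombination_bary] at h
  refine h.trans ?_
  simp only [Finset.mem_compl, Finset.mem_singleton, not_not, forall_eq]
  constructor
  · rintro ⟨h1, h2⟩
    refine ⟨h2, fun k => ?_⟩
    rcases eq_or_ne k i with rfl | hk
    exacts [h2.ge, h1 k hk]
  · exact fun h => ⟨fun k _ => h.2 k, h.1⟩

theorem setOf_bary_pos_subset_interior : {x | ∀ k, 0 < bary S k x} ⊆ interior S.closedInterior := by
  refine interior_maximal (fun x hx => mem_closedInterior_iff.2 fun k => (hx k).le) ?_
  simp only [Set.ofPred_forall]
  exact isOpen_iInter_of_finite fun k => isOpen_lt continuous_const (continuous_bary k)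

theorem nonempty_setOf_bary_pos : ∃ x, ∀ k, 0 < bary S k x := by
  let w : Fin (d + 1) → ℝ := fun _ => 1 / (d + 1)
  have hw : ∑ k, w k = 1 := by simp [w]; field_simp
  refine ⟨Finset.univ.affineCombination ℝ (simplexBasis S) w, fun k => ?_⟩
  rw [bary, (simplexBasis S).coord_apply_combination_of_mem (Finset.mem_univ k) hw]
  positivity

theorem isCompact_facet [NeZero d] (i : Fin (d + 1)) :
    IsCompact (S.faceOpposite i).closedInterior :=
  (S.faceOpposite i).isCompact_closedInterior

theorem convex_closedInterior : Convex ℝ S.closedInterior := by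
  rw [← Affine.Simplex.convexHull_eq_closedInterior]
  exact convex_convexHull _ _

theorem uniqueDiffOn_closedInterior : UniqueDiffOn ℝ S.closedInterior := by
  refine uniqueDiffOn_convex convex_closedInterior ?_
  obtain ⟨x, hx⟩ := nonempty_setOf_bary_pos (S := S)
  exact ⟨x, setOf_bary_pos_subset_interior hx⟩

variable [NeZero d]

variable (S) in
/-- The outward unit normal of the facet opposite to a vertex. -/
noncomputable def outwardNormal (i : Fin (d + 1)) : Pt d :=
  (S.height i)⁻¹ • (S.altitudeFoot i - S.points i)

theorem norm_outwardNormal (i : Fin (d + 1)) : ‖outwardNormal S i‖ = 1 := by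
  rw [outwardNormal, norm_smul, ← dist_eq_norm, dist_comm, ← Affine.Simplex.height, norm_inv,
    Real.norm_of_nonneg (S.height_pos i).le, inv_mul_cancel₀ (S.height_pos i).ne']

/-- The coordinate is the distance from the facet in units of the height, so its gradient is `-n /
height`. This is checked on the edges issuing from vertex `i`, which form a basis and all have the
same component along the altitude. -/
theorem bary_linear (i : Fin (d + 1)) (w : Pt d) :
    (bary S i).linear w = -(inner ℝ (outwardNormal S i) w / S.height i) := by
  have hh := (S.height_pos i).ne'
  let f : Pt d →ₗ[ℝ] ℝ := -((S.height i)⁻¹ • (innerₛₗ ℝ (outwardNormal S i)))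
  have hf : ∀ w, f w = -(inner ℝ (outwardNormal S i) w / S.height i) := fun w => by
    simp [f, div_eq_inv_mul]
  rw [← hf]
  congr 1
  refine ((simplexBasis S).basisOf i).ext fun ⟨k, hk⟩ => ?_
  rw [AffineBasis.basisOf_apply, hf]
  change (bary S i).linear (S.points k - S.points i) =
    -(inner ℝ (outwardNormal S i) (S.points k - S.points i) / S.height i)
  have h1 := S.inner_vsub_vsub_altitudeFoot_eq_height_sq hk.symm
  rw [vsub_eq_sub, vsub_eq_sub] at h1
  rw [bary_linear_sub, if_neg (Ne.symm hk), if_pos rfl, outwardNormal, real_inner_smul_left,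
    ← neg_sub (S.points i) (S.altitudeFoot i), ← neg_sub (S.points i) (S.points k),
    inner_neg_neg, real_inner_comm, h1]
  field_simp
  norm_num

theorem inner_outwardNormal (i : Fin (d + 1)) (w : Pt d) :
    inner ℝ (outwardNormal S i) w = -(S.height i * (bary S i).linear w) := by
  rw [bary_linear]
  field_simp

end Barycentric

/-! ### Lebesgue measure in oblique coordinates. -/

section Shear

/-- With `e = a n + e_W` and `e_W ⟂ n`, the map scales the line by `a`, translates the hyperplane by
`t e_W`, and recombines the orthogonal components. Only the scaling changes the measure, hence the
factor `|⟨n, e⟩|`. -/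
theorem measurePreserving_shear [NeZero d] {n : Pt d} (hn : ‖n‖ = 1) (e p : Pt d)
    (he : inner ℝ n e ≠ 0) :
    MeasurePreserving (fun q : ℝ × (Submodule.span ℝ {n})ᗮ => p + (q.2 : Pt d) + q.1 • e)
      ((ENNReal.ofReal |inner ℝ n e| • (volume : Measure ℝ)).prod volume) volume := by
  set W := (Submodule.span ℝ {n})ᗮ
  set a : ℝ := inner ℝ n e
  let eW : W := W.orthogonalProjectionOnto e
  have heW : e = a • n + (eW : Pt d) := by
    have h1 := Submodule.starProjection_add_starProjection_orthogonal (K := Submodule.span ℝ {n}) e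
    rw [Submodule.starProjection_unit_singleton ℝ hn e] at h1
    exact h1.symm
  have m1 : MeasurePreserving (fun t : ℝ => a * t) (ENNReal.ofReal |a| • volume) volume :=
    ⟨measurable_const_mul a, by rw [Measure.map_smul, Real.smul_map_volume_mul_left he]⟩
  have m2 : MeasurePreserving (fun q : ℝ × W => (a * q.1, q.2 + q.1 • eW))
      ((ENNReal.ofReal |a| • (volume : Measure ℝ)).prod volume) (volume.prod volume) := by
    refine m1.skew_product (g := fun t y => y + t • eW) ?_ (Filter.Eventually.of_forall fun t => ?_)
    · fun_prop
    · exact (measurePreserving_add_right volume (t • eW)).map_eq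
  have m3 : MeasurePreserving (Prod.map (LinearIsometryEquiv.toSpanUnitSingleton (𝕜 := ℝ) n hn)
      (id : W → W)) (volume.prod volume) (volume.prod volume) :=
    (LinearIsometryEquiv.measurePreserving _).prod (MeasurePreserving.id _)
  have m4 := ((Submodule.span ℝ {n}).measurePreserving_measurableEquivProd p).symm
  rw [show Module.finrank ℝ (Pt d) = d by simp,
    EuclideanSpace.euclideanHausdorffMeasure_eq_volume] at m4
  have m5 := m4.comp (m3.comp m2)
  refine Eq.subst (motive := fun F : ℝ × W → Pt d => MeasurePreserving F
    ((ENNReal.ofReal |a| • (volume : Measure ℝ)).prod volume) volume) ?_ m5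
  funext q
  simp only [Function.comp, Prod.map, id, Submodule.measurableEquivProd_symm_apply, vadd_eq_add,
    Submodule.coe_add, Submodule.coe_smul]
  rw [LinearIsometryEquiv.toSpanUnitSingleton_apply]
  conv_rhs => rw [heW]
  simp only [smul_add, smul_smul, mul_comm]
  abel

end Shear

end EulerHDG

/-! ### Surface integrals over facets, and Fubini on a simplex. -/

namespace EulerHDG

variable {d : ℕ} {S : Affine.Simplex ℝ (Pt d) d}

theorem isometry_add_coe (W : Submodule ℝ (Pt d)) (p : Pt d) :
    Isometry (fun y : W => p + (y : Pt d)) :=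
  (IsometryEquiv.addLeft p).isometry.comp isometry_subtype_coe

theorem measurableEmbedding_add_coe (W : Submodule ℝ (Pt d)) (p : Pt d) :
    MeasurableEmbedding (fun y : W => p + (y : Pt d)) :=
  (isometry_add_coe W p).isClosedEmbedding.measurableEmbedding

theorem bary_add_smul_edge (i j : Fin (d + 1)) (x : Pt d) (t : ℝ) (k : Fin (d + 1)) :
    bary S k (x + t • (S.points i - S.points j)) =
      bary S k x + t * ((if k = i then 1 else 0) - (if k = j then 1 else 0)) := by
  rw [bary_add, map_smul, bary_linear_sub, smul_eq_mul]

theorem volume_real_simplex_pos : 0 < volume.real S.closedInterior := by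
  have hK : IsCompact S.closedInterior := S.isCompact_closedInterior
  obtain ⟨x, hx⟩ := nonempty_setOf_bary_pos (S := S)
  refine ENNReal.toReal_pos ?_ hK.measure_lt_top.ne
  exact (Measure.measure_pos_of_nonempty_interior _ ⟨x, setOf_bary_pos_subset_interior hx⟩).ne'

variable (S) in
/-- The shear along an edge which takes the facet opposite to one end to the facet opposite to the
other. -/
noncomputable def facetShear (i j : Fin (d + 1)) (x : Pt d) : Pt d :=
  x + bary S j x • (S.points i - S.points j)

theorem bary_facetShear {i j : Fin (d + 1)} (hij : i ≠ j) {x : Pt d} (hx : bary S i x = 0) :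
    bary S i (facetShear S i j x) = bary S j x := by
  rw [facetShear, bary_add_smul_edge, if_neg hij, if_pos rfl, hx]; ring

variable [NeZero d]

variable (S) in
/-- The hyperplane through the origin that is parallel to a facet. -/
noncomputable abbrev facetDirection (i : Fin (d + 1)) : Submodule ℝ (Pt d) :=
  (Submodule.span ℝ {outwardNormal S i})ᗮ

theorem mem_facetDirection {i : Fin (d + 1)} {w : Pt d} :
    w ∈ facetDirection S i ↔ (bary S i).linear w = 0 := by
  rw [Submodule.mem_orthogonal_singleton_iff_inner_right, inner_outwardNormal, neg_eq_zero,
    mul_eq_zero, or_iff_right (S.height_pos i).ne']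

theorem finrank_facetDirection (i : Fin (d + 1)) :
    Module.finrank ℝ (facetDirection S i) = d - 1 := by
  have hne : outwardNormal S i ≠ 0 := by
    rw [← norm_ne_zero_iff, norm_outwardNormal]; exact one_ne_zero
  have h := (Submodule.span ℝ {outwardNormal S i}).finrank_add_finrank_orthogonal
  rw [finrank_span_singleton hne, finrank_euclideanSpace_fin] at h
  change 1 + Module.finrank ℝ (facetDirection S i) = d at h
  omega

/-- An isometry preserves Hausdorff measure, which on a `(d-1)`-dimensional inner product space is
Lebesgue measure. Surface integrals thereby become Lebesgue integrals over a hyperplane. -/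
theorem map_add_coe_volume (i : Fin (d + 1)) (p : Pt d) :
    Measure.map (fun y : facetDirection S i => p + (y : Pt d)) volume =
      (μHE[d - 1] : Measure (Pt d)).restrict
        (Set.range fun y : facetDirection S i => p + (y : Pt d)) := by
  rw [← (isometry_add_coe (facetDirection S i) p).map_euclideanHausdorffMeasure,
    ← finrank_facetDirection (S := S) i, InnerProductSpace.euclideanHausdorffMeasure_eq_volume]

theorem facet_subset_range {i : Fin (d + 1)} {p : Pt d} (hp : bary S i p = 0) :
    (S.faceOpposite i).closedInterior ⊆ Set.range fun y : facetDirection S i => p + (y : Pt d) := by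
  intro x hx
  have h : (bary S i).linear (x - p) = 0 := by
    have h1 := bary_add i p (x - p) (S := S)
    rw [add_sub_cancel, (mem_facet_iff.1 hx).1, hp, zero_add] at h1
    exact h1.symm
  exact ⟨⟨x - p, mem_facetDirection.2 h⟩, add_sub_cancel p x⟩

theorem measurableSet_facet (i : Fin (d + 1)) :
    MeasurableSet (S.faceOpposite i).closedInterior := (isCompact_facet i).measurableSet

theorem integral_facet_eq {i : Fin (d + 1)} {p : Pt d} (hp : bary S i p = 0) (G : Pt d → ℝ) :
    ∫ x in (S.faceOpposite i).closedInterior, G x ∂μHE[d - 1] =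
      ∫ y : facetDirection S i, (S.faceOpposite i).closedInterior.indicator G (p + (y : Pt d)) := by
  rw [← (measurableEmbedding_add_coe (facetDirection S i) p).integral_map, map_add_coe_volume,
    setIntegral_indicator (measurableSet_facet i), Set.inter_eq_right.2 (facet_subset_range hp)]

theorem exists_bary_eq_zero (i : Fin (d + 1)) : ∃ p, bary S i p = 0 := by
  obtain ⟨j, hj⟩ := exists_ne i
  exact ⟨S.points j, by rw [bary_point, if_neg hj.symm]⟩

theorem euclideanHausdorffMeasure_facet_lt_top (i : Fin (d + 1)) :
    (μHE[d - 1] : Measure (Pt d)) (S.faceOpposite i).closedInterior < ⊤ := by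
  obtain ⟨p, hp⟩ := exists_bary_eq_zero (S := S) i
  have h1 : (μHE[d - 1] : Measure (Pt d)) (S.faceOpposite i).closedInterior =
      Measure.map (fun y : facetDirection S i => p + (y : Pt d)) volume
        (S.faceOpposite i).closedInterior := by
    rw [map_add_coe_volume, Measure.restrict_apply (measurableSet_facet i),
      Set.inter_eq_left.2 (facet_subset_range hp)]
  rw [h1, (measurableEmbedding_add_coe (facetDirection S i) p).map_apply]
  exact ((isometry_add_coe (facetDirection S i) p).isClosedEmbedding.isCompact_preimage
    (isCompact_facet i)).measure_lt_top

theorem integrableOn_facet (i : Fin (d + 1)) {G : Pt d → ℝ}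
    (hG : ContinuousOn G (S.faceOpposite i).closedInterior) :
    IntegrableOn G (S.faceOpposite i).closedInterior μHE[d - 1] := by
  have : IsFiniteMeasure
      ((μHE[d - 1] : Measure (Pt d)).restrict (S.faceOpposite i).closedInterior) :=
    ⟨by rw [Measure.restrict_apply_univ]; exact euclideanHausdorffMeasure_facet_lt_top i⟩
  obtain ⟨C, hC⟩ := (isCompact_facet i).exists_bound_of_continuousOn hG
  refine Integrable.of_bound (hG.aestronglyMeasurable (measurableSet_facet i)) C ?_
  exact ae_restrict_of_forall_mem (measurableSet_facet i) hC

section Fubini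

variable {i j : Fin (d + 1)}

/-- Along the edge direction only two coordinates change: the `i`-th grows from 0 like `t`, and the
`j`-th decreases like `bary S j x - t`. The line therefore meets the simplex in exactly this chord.
-/
theorem add_smul_edge_mem_iff (hij : i ≠ j) {x : Pt d} (hx : bary S i x = 0) (t : ℝ) :
    x + t • (S.points i - S.points j) ∈ S.closedInterior ↔
      x ∈ (S.faceOpposite i).closedInterior ∧ t ∈ Set.Icc 0 (bary S j x) := by
  rw [mem_closedInterior_iff, mem_facet_iff, Set.mem_Icc]
  simp only [bary_add_smul_edge]
  constructor
  · intro h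
    have hi := h i
    have hj := h j
    simp only [if_true, if_neg hij, if_neg hij.symm, hx] at hi hj
    refine ⟨⟨hx, fun k => ?_⟩, by linarith, by linarith⟩
    rcases eq_or_ne k i with rfl | hki
    · exact hx.ge
    rcases eq_or_ne k j with rfl | hkj
    · linarith
    have hk := h k
    simp only [if_neg hki, if_neg hkj] at hk
    linarith
  · rintro ⟨⟨-, h⟩, h0, h1⟩ k
    rcases eq_or_ne k i with rfl | hki
    · simp only [if_true, if_neg hij, hx]; linarith
    rcases eq_or_ne k j with rfl | hkj
    · simp only [if_true, if_neg hki]; linarith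
    simp only [if_neg hki, if_neg hkj]
    linarith [h k]

/-- Integration over a simplex along the lines parallel to an edge. -/
theorem integral_simplex_eq (hij : i ≠ j) {f : Pt d → ℝ} (hf : ContinuousOn f S.closedInterior) :
    ∫ x in S.closedInterior, f x = S.height i *
      ∫ y in (S.faceOpposite i).closedInterior,
        (∫ t in (0 : ℝ)..(bary S j y), f (y + t • (S.points i - S.points j))) ∂μHE[d - 1] := by
  have hK : IsCompact S.closedInterior := S.isCompact_closedInterior
  set e := S.points i - S.points j with he
  set p := S.points j with hp
  have hp0 : bary S i p = 0 := by rw [hp, bary_point, if_neg hij]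
  -- The edge rises from the plane of facet `i` to the opposite vertex, so the Jacobian of the
  -- oblique coordinates is the height.
  have hin : inner ℝ (outwardNormal S i) e = -S.height i := by
    rw [inner_outwardNormal, he, bary_linear_sub, if_pos rfl, if_neg hij]; ring
  have habs : |inner ℝ (outwardNormal S i) e| = S.height i := by
    rw [hin, abs_neg, abs_of_pos (S.height_pos i)]
  have hmp := measurePreserving_shear (norm_outwardNormal (S := S) i) e p
    (by rw [hin]; exact (neg_neg_of_pos (S.height_pos i)).ne)
  rw [habs] at hmp
  have hint : Integrable (S.closedInterior.indicator f) :=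
    (integrable_indicator_iff hK.measurableSet).2 (hf.integrableOn_compact hK)
  have hint' := (hmp.integrable_comp hint.aestronglyMeasurable).2 hint
  rw [← integral_indicator hK.measurableSet]
  conv_lhs => rw [← hmp.map_eq]
  rw [integral_map hmp.aemeasurable (by rw [hmp.map_eq]; exact hint.aestronglyMeasurable),
    integral_facet_eq hp0, ← integral_const_mul]
  refine (integral_prod_symm _ hint').trans ?_
  refine integral_congr_ae (Filter.Eventually.of_forall fun y => ?_)
  have hy : bary S i (p + (y : Pt d)) = 0 := by
    rw [bary_add, hp0, zero_add]; exact mem_facetDirection.1 y.2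
  simp only [Function.comp]
  rw [integral_smul_measure, ENNReal.toReal_ofReal (S.height_pos i).le, smul_eq_mul]
  congr 1
  by_cases hF : p + (y : Pt d) ∈ (S.faceOpposite i).closedInterior
  · rw [Set.indicator_of_mem hF, intervalIntegral.integral_of_le ((mem_facet_iff.1 hF).2 j),
      ← integral_Icc_eq_integral_Ioc, ← integral_indicator measurableSet_Icc]
    congr 1
    funext t
    by_cases ht : t ∈ Set.Icc 0 (bary S j (p + (y : Pt d)))
    · rw [Set.indicator_of_mem ht,
        Set.indicator_of_mem ((add_smul_edge_mem_iff hij hy t).2 ⟨hF, ht⟩)]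
    · rw [Set.indicator_of_notMem ht,
        Set.indicator_of_notMem fun h => ht ((add_smul_edge_mem_iff hij hy t).1 h).2]
  · rw [Set.indicator_of_notMem hF]
    refine integral_eq_zero_of_ae (Filter.Eventually.of_forall fun t => ?_)
    exact Set.indicator_of_notMem (fun h => hF ((add_smul_edge_mem_iff hij hy t).1 h).1) _

/-- The shear sends a point of facet `i` to the other end of its chord, which lies on facet `j`. -/
theorem facetShear_mem_iff (hij : i ≠ j) {x : Pt d} (hx : bary S i x = 0) :
    facetShear S i j x ∈ (S.faceOpposite j).closedInterior ↔
      x ∈ (S.faceOpposite i).closedInterior := by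
  have hj : bary S j (facetShear S i j x) = 0 := by
    rw [facetShear, bary_add_smul_edge, if_neg hij.symm, if_pos rfl]; ring
  have h1 : facetShear S i j x ∈ (S.faceOpposite j).closedInterior ↔
      facetShear S i j x ∈ S.closedInterior := by
    rw [mem_facet_iff, mem_closedInterior_iff, and_iff_right hj]
  rw [h1, facetShear, add_smul_edge_mem_iff hij hx, and_iff_left_iff_imp]
  exact fun h => ⟨(mem_facet_iff.1 h).2 j, le_rfl⟩

/-- The linear part of the shear between two facets. -/
noncomputable def facetDirectionEquiv (hij : i ≠ j) :
    facetDirection S i ≃ₗ[ℝ] facetDirection S j :=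
  LinearEquiv.ofLinearMap
    (((LinearMap.id + (bary S j).linear.smulRight (S.points i - S.points j)).domRestrict
      (facetDirection S i)).codRestrict (facetDirection S j) fun y => by
        rw [mem_facetDirection]
        simp [bary_linear_sub, hij.symm, -map_sub])
    (((LinearMap.id + (bary S i).linear.smulRight (S.points j - S.points i)).domRestrict
      (facetDirection S j)).codRestrict (facetDirection S i) fun y => by
        rw [mem_facetDirection]
        simp [bary_linear_sub, hij, -map_sub])
    (by
      ext1 y
      have hy := mem_facetDirection.1 y.2
      apply Subtype.ext
      simp [bary_linear_sub, hy, -map_sub, hij.symm]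
      module)
    (by
      ext1 y
      have hy := mem_facetDirection.1 y.2
      apply Subtype.ext
      simp [bary_linear_sub, hy, -map_sub, hij]
      module)

theorem coe_facetDirectionEquiv (hij : i ≠ j) (y : facetDirection S i) :
    (facetDirectionEquiv hij y : Pt d) =
      y + (bary S j).linear (y : Pt d) • (S.points i - S.points j) := rfl

/-- The shear is an affine bijection between the planes of the two facets, so by uniqueness of Haar
measure it multiplies area by a constant. Its value is determined in
`height_mul_integral_facetShear`. -/
theorem exists_integral_facetShear (hij : i ≠ j) : ∃ c : ℝ, ∀ G : Pt d → ℝ,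
    ∫ x in (S.faceOpposite i).closedInterior, G (facetShear S i j x) ∂μHE[d - 1] =
      c * ∫ x in (S.faceOpposite j).closedInterior, G x ∂μHE[d - 1] := by
  let L := (facetDirectionEquiv (S := S) hij).toContinuousLinearEquiv
  have hL := L.isAddHaarMeasure_map volume
  have hc := Measure.isAddLeftInvariant_eq_smul (Measure.map L volume) volume
  refine ⟨Measure.addHaarScalarFactor (Measure.map L volume) volume, fun G => ?_⟩
  have hpi : bary S i (S.points j) = 0 := by rw [bary_point, if_neg hij]
  have hpj : bary S j (S.points i) = 0 := by rw [bary_point, if_neg hij.symm]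
  rw [integral_facet_eq hpi, integral_facet_eq hpj]
  have h2 := integral_smul_nnreal_measure (μ := (volume : Measure (facetDirection S j)))
    (fun z => (S.faceOpposite j).closedInterior.indicator G (S.points i + (z : Pt d)))
    (Measure.addHaarScalarFactor (Measure.map L volume) volume)
  rw [← hc, (show MeasurableEmbedding L from L.toHomeomorph.measurableEmbedding).integral_map] at h2
  refine Eq.trans ?_ (h2.trans (NNReal.smul_def _ _))
  congr 1
  funext y
  have hy : bary S i (S.points j + (y : Pt d)) = 0 := by
    rw [bary_add, hpi, zero_add]; exact mem_facetDirection.1 y.2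
  have key : S.points i + ((L y : facetDirection S j) : Pt d) =
      facetShear S i j (S.points j + (y : Pt d)) := by
    change S.points i + (facetDirectionEquiv hij y : Pt d) = _
    rw [coe_facetDirectionEquiv, facetShear, bary_add, bary_point, if_pos rfl]
    module
  change _ = (S.faceOpposite j).closedInterior.indicator G
    (S.points i + ((L y : facetDirection S j) : Pt d))
  rw [key]
  by_cases h : S.points j + (y : Pt d) ∈ (S.faceOpposite i).closedInterior
  · rw [Set.indicator_of_mem h, Set.indicator_of_mem ((facetShear_mem_iff hij hy).2 h)]
  · rw [Set.indicator_of_notMem h,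
      Set.indicator_of_notMem fun h' => h ((facetShear_mem_iff hij hy).1 h')]

/-- Integrating 1 along each chord gives its length parameter `bary S j`. The right side is the same
for every pair `i`, `j`, which allows facets to be compared. -/
theorem height_mul_integral_bary (hij : i ≠ j) : S.height i *
    ∫ x in (S.faceOpposite i).closedInterior, bary S j x ∂μHE[d - 1] =
      volume.real S.closedInterior := by
  have h := integral_simplex_eq (S := S) hij (f := fun _ => (1 : ℝ)) continuousOn_const
  simpa using h.symm

/-- The factor `c` of the shear is `height j / height i`. No determinant is computed: the test
function `bary S i` on facet `j` pulls back to `bary S j` on facet `i`, and both integrals are the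
volume divided by a height. -/
theorem height_mul_integral_facetShear (hij : i ≠ j) (G : Pt d → ℝ) :
    S.height i * ∫ x in (S.faceOpposite i).closedInterior,
      G (facetShear S i j x) ∂μHE[d - 1] =
    S.height j * ∫ x in (S.faceOpposite j).closedInterior, G x ∂μHE[d - 1] := by
  obtain ⟨c, hc⟩ := exists_integral_facetShear (S := S) hij
  have h1 := height_mul_integral_bary (S := S) hij
  have h2 := height_mul_integral_bary (S := S) hij.symm
  have h3 : ∫ x in (S.faceOpposite i).closedInterior, bary S j x ∂μHE[d - 1] =
      c * ∫ x in (S.faceOpposite j).closedInterior, bary S i x ∂μHE[d - 1] := by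
    rw [← hc]
    exact setIntegral_congr_fun (measurableSet_facet i)
      fun x hx => (bary_facetShear hij (mem_facet_iff.1 hx).1).symm
  have hpos := volume_real_simplex_pos (S := S)
  have h4 : S.height i * c = S.height j := by
    have h5 : ∫ x in (S.faceOpposite j).closedInterior, bary S i x ∂μHE[d - 1] ≠ 0 := by
      intro h0
      rw [h0, mul_zero] at h2
      exact hpos.ne h2
    refine mul_right_cancel₀ h5 ?_
    rw [h2, mul_assoc, ← h3, h1]
  rw [hc, ← mul_assoc, h4]

end Fubini

/-! ### The divergence theorem on a simplex. -/

section Divergence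

variable {g : Pt d → ℝ} {g' : Pt d → Pt d →L[ℝ] ℝ}

/-- The fundamental theorem of calculus on each chord parallel to the edge, which starts on facet
`i` and ends on facet `j`; the shear transports the end values to an integral over facet `j`. -/
theorem integral_fderiv_edge {i j : Fin (d + 1)} (hij : i ≠ j)
    (hg : ∀ x ∈ S.closedInterior, HasFDerivWithinAt g (g' x) S.closedInterior x)
    (hg' : ContinuousOn g' S.closedInterior) :
    ∫ x in S.closedInterior, g' x (S.points i - S.points j) =
      S.height j * ∫ x in (S.faceOpposite j).closedInterior, g x ∂μHE[d - 1] -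
      S.height i * ∫ x in (S.faceOpposite i).closedInterior, g x ∂μHE[d - 1] := by
  have hgc : ContinuousOn g S.closedInterior := fun x hx => (hg x hx).continuousWithinAt
  have hsub : (S.faceOpposite i).closedInterior ⊆ S.closedInterior :=
    S.closedInterior_faceOpposite_subset_closedInterior i
  have hmem : ∀ x ∈ (S.faceOpposite i).closedInterior, ∀ t ∈ Set.Icc 0 (bary S j x),
      x + t • (S.points i - S.points j) ∈ S.closedInterior := fun x hx t ht =>
    (add_smul_edge_mem_iff hij (mem_facet_iff.1 hx).1 t).2 ⟨hx, ht⟩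
  rw [integral_simplex_eq hij (hg'.clm_apply continuousOn_const),
    ← height_mul_integral_facetShear hij, ← mul_sub, ← integral_sub]
  · congr 1
    refine setIntegral_congr_fun (measurableSet_facet i) fun x hx => ?_
    have hpath : ContinuousOn (fun t : ℝ => x + t • (S.points i - S.points j))
        (Set.Icc 0 (bary S j x)) := by fun_prop
    have := intervalIntegral.integral_eq_sub_of_hasDerivAt_of_le ((mem_facet_iff.1 hx).2 j)
      (hgc.comp hpath (hmem x hx)) (f' := fun t => g' (x + t • (S.points i - S.points j))
        (S.points i - S.points j)) (fun t ht => ?_) ?_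
    · rw [this]
      simp [facetShear]
    · have h1 : HasDerivWithinAt (fun t : ℝ => x + t • (S.points i - S.points j))
          (S.points i - S.points j) (Set.Icc 0 (bary S j x)) t := by
        simpa using ((hasDerivWithinAt_id t _).smul_const
          (S.points i - S.points j)).const_add x
      exact ((hg _ (hmem x hx t (Set.Ioo_subset_Icc_self ht))).comp_hasDerivWithinAt t h1
        (hmem x hx)).hasDerivAt (Icc_mem_nhds ht.1 ht.2)
    · refine ContinuousOn.intervalIntegrable ?_
      rw [Set.uIcc_of_le ((mem_facet_iff.1 hx).2 j)]
      exact (hg'.comp hpath (hmem x hx)).clm_apply continuousOn_const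
  · refine integrableOn_facet i (hgc.comp ?_ fun x hx => ?_)
    · unfold facetShear
      exact (continuous_id.add ((continuous_bary j).smul continuous_const)).continuousOn
    · exact hmem x hx _ ⟨(mem_facet_iff.1 hx).2 j, le_rfl⟩
  · exact integrableOn_facet i (hgc.mono hsub)

/-- The divergence theorem on a simplex, for a constant direction. -/
theorem integral_fderiv_simplex
    (hg : ∀ x ∈ S.closedInterior, HasFDerivWithinAt g (g' x) S.closedInterior x)
    (hg' : ContinuousOn g' S.closedInterior) (e : Pt d) :
    ∫ x in S.closedInterior, g' x e = ∑ i, ∫ x in (S.faceOpposite i).closedInterior,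
      g x * inner ℝ (outwardNormal S i) e ∂μHE[d - 1] := by
  have hK : IsCompact S.closedInterior := S.isCompact_closedInterior
  have hint : IntegrableOn g' S.closedInterior := hg'.integrableOn_compact hK
  let A : Pt d →ₗ[ℝ] ℝ := (∫ x in S.closedInterior, g' x : Pt d →L[ℝ] ℝ).toLinearMap
  let B : Pt d →ₗ[ℝ] ℝ := ∑ i, (∫ x in (S.faceOpposite i).closedInterior, g x ∂μHE[d - 1]) •
    innerₛₗ ℝ (outwardNormal S i)
  have hA : ∀ e, A e = ∫ x in S.closedInterior, g' x e := fun e =>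
    ContinuousLinearMap.integral_apply hint e
  have hB : ∀ e, B e = ∑ i, ∫ x in (S.faceOpposite i).closedInterior,
      g x * inner ℝ (outwardNormal S i) e ∂μHE[d - 1] := fun e => by
    simp [B, LinearMap.sum_apply, integral_mul_const]
  rw [← hA, ← hB]
  congr 1
  -- Both sides are linear in the direction, so the edges at vertex 0 suffice.
  refine ((simplexBasis S).basisOf 0).ext fun ⟨k, hk⟩ => ?_
  rw [AffineBasis.basisOf_apply]
  change A (S.points k - S.points 0) = B (S.points k - S.points 0)
  rw [hA, hB, integral_fderiv_edge hk hg hg']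
  simp only [integral_mul_const, inner_outwardNormal, bary_linear_sub]
  -- The edge from vertex 0 to vertex `k` is parallel to every facet except those opposite to its
  -- two ends.
  have : ∀ i, (∫ x in (S.faceOpposite i).closedInterior, g x ∂μHE[d - 1]) *
      -(S.height i * ((if i = k then 1 else 0) - (if i = 0 then 1 else 0))) =
      (if i = 0 then S.height i *
        ∫ x in (S.faceOpposite i).closedInterior, g x ∂μHE[d - 1] else 0) -
      (if i = k then S.height i *
        ∫ x in (S.faceOpposite i).closedInterior, g x ∂μHE[d - 1] else 0) := by
    intro i
    split_ifs <;> ring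
  simp only [this, Finset.sum_sub_distrib, Finset.sum_ite_eq', Finset.mem_univ, if_true]

end Divergence

end EulerHDG

namespace EulerHDG

variable {d : ℕ}

/-! ### Opposite normals on a facet common to two simplices. -/

section AdjacentSimplices

variable {S S' : Affine.Simplex ℝ (Pt d) d}

theorem affineMap_eq_sum_bary (a : Pt d →ᵃ[ℝ] ℝ) (x : Pt d) :
    a x = ∑ l, bary S l x * a (S.points l) := by
  have h := Finset.univ.map_affineCombination S.points (fun k => bary S k x) (sum_bary x) a
  rw [affineCombination_bary, Finset.affineCombination_eq_linear_combination _ _ _ (sum_bary x)] at h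
  simpa using h

variable [NeZero d]

theorem exists_mem_facet_bary_pos (i : Fin (d + 1)) :
    ∃ x, bary S i x = 0 ∧ ∀ k, k ≠ i → 0 < bary S k x := by
  have hd : (0 : ℝ) < d := by exact_mod_cast NeZero.pos d
  let w : Fin (d + 1) → ℝ := fun k => if k = i then 0 else 1 / d
  have hw : ∑ k, w k = 1 := by
    have h1 : ∀ k, w k = 1 / d - (if k = i then 1 / (d : ℝ) else 0) := fun k => by
      simp only [w]; split_ifs <;> ring
    simp only [h1, Finset.sum_sub_distrib, Finset.sum_ite_eq', Finset.mem_univ, if_true,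
      Finset.sum_const, Finset.card_univ, Fintype.card_fin, nsmul_eq_mul]
    push_cast
    field_simp
    ring
  have hb : ∀ k, bary S k (Finset.univ.affineCombination ℝ (simplexBasis S) w) = w k := fun k => by
    rw [bary, (simplexBasis S).coord_apply_combination_of_mem (Finset.mem_univ k) hw]
  refine ⟨_, by rw [hb]; simp [w], fun k hk => ?_⟩
  rw [hb]
  simp only [w, if_neg hk]
  positivity

variable {i i' : Fin (d + 1)} {z : Pt d}

/-- A point in the relative interior of a facet of one simplex is in the relative interior of a
coinciding facet of another simplex. -/
theorem bary_pos_of_facet_eq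
    (hF : (S.faceOpposite i).closedInterior =
      (fun y => z + y) '' (S'.faceOpposite i').closedInterior)
    {x : Pt d} (hx : bary S i x = 0) (hx' : ∀ k, k ≠ i → 0 < bary S k x) {k : Fin (d + 1)}
    (hk : k ≠ i') : 0 < bary S' k (x - z) := by
  have hmem : ∀ y ∈ (S.faceOpposite i).closedInterior,
      y - z ∈ (S'.faceOpposite i').closedInterior := by
    intro y hy
    rw [hF] at hy
    obtain ⟨w, hw, rfl⟩ := hy
    simpa using hw
  -- The affine function `a` is nonnegative at the vertices of the facet. If it vanished at a
  -- relative interior point, it would vanish at all these vertices, hence on the whole facet; but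
  -- it is 1 at the `k`-th vertex of the other simplex.
  let a : Pt d →ᵃ[ℝ] ℝ := (bary S' k).comp (AffineMap.id ℝ (Pt d) - AffineMap.const ℝ (Pt d) z)
  have ha : ∀ y, a y = bary S' k (y - z) := fun y => rfl
  have hav : ∀ l, l ≠ i → 0 ≤ a (S.points l) := fun l hl =>
    (mem_facet_iff.1 (hmem _ (S.point_mem_closedInterior_faceOpposite_iff.2 hl))).2 k
  have hterm : ∀ l ∈ Finset.univ, 0 ≤ bary S l x * a (S.points l) := by
    intro l _
    rcases eq_or_ne l i with rfl | hl
    · rw [hx, zero_mul]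
    · exact mul_nonneg (hx' l hl).le (hav l hl)
  rw [← ha]
  have hnn : 0 ≤ a x := by
    rw [affineMap_eq_sum_bary (S := S) a x]
    exact Finset.sum_nonneg hterm
  refine lt_of_le_of_ne hnn fun h0 => ?_
  rw [affineMap_eq_sum_bary (S := S) a x, eq_comm, Finset.sum_eq_zero_iff_of_nonneg hterm] at h0
  have hz : ∀ l, l ≠ i → a (S.points l) = 0 := fun l hl =>
    (mul_eq_zero.1 (h0 l (Finset.mem_univ l))).resolve_left (hx' l hl).ne'
  have hq : z + S'.points k ∈ (S.faceOpposite i).closedInterior := by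
    rw [hF]
    exact ⟨_, S'.point_mem_closedInterior_faceOpposite_iff.2 hk, rfl⟩
  have h1 : a (z + S'.points k) = 1 := by
    rw [ha, add_sub_cancel_left, bary_point, if_pos rfl]
  rw [affineMap_eq_sum_bary (S := S) a, Finset.sum_eq_zero] at h1
  · exact zero_ne_one h1
  · intro l _
    rcases eq_or_ne l i with rfl | hl
    · rw [(mem_facet_iff.1 hq).1, zero_mul]
    · rw [hz l hl, mul_zero]

/-- The two barycentric coordinates attached to the facet vanish on the same hyperplane, up to the
translation, so their linear parts are proportional. The unit normals are multiples of their
gradients. -/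
theorem outwardNormal_eq_or_eq_neg
    (hF : (S.faceOpposite i).closedInterior =
      (fun y => z + y) '' (S'.faceOpposite i').closedInterior) :
    outwardNormal S' i' = outwardNormal S i ∨ outwardNormal S' i' = -outwardNormal S i := by
  have hmem : ∀ y ∈ (S.faceOpposite i).closedInterior, bary S' i' (y - z) = 0 := by
    intro y hy
    rw [hF] at hy
    obtain ⟨w, hw, rfl⟩ := hy
    rw [add_sub_cancel_left]
    exact (mem_facet_iff.1 hw).1
  have hz : ∀ l, l ≠ i → bary S' i' (S.points l - z) = 0 := fun l hl =>
    hmem _ (S.point_mem_closedInterior_faceOpposite_iff.2 hl)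
  obtain ⟨m, hm⟩ := exists_ne i
  let κ := (bary S' i').linear (S.points i - S.points m)
  have hlin : (bary S' i').linear = κ • (bary S i).linear := by
    refine ((simplexBasis S).basisOf m).ext fun ⟨k, hk⟩ => ?_
    rw [AffineBasis.basisOf_apply]
    change (bary S' i').linear (S.points k - S.points m) =
      κ * (bary S i).linear (S.points k - S.points m)
    rw [bary_linear_sub, if_neg hm.symm]
    rcases eq_or_ne k i with rfl | hki
    · simp [κ]
    · have h := bary_add (S := S') i' (S.points m - z) (S.points k - S.points m)
      rw [show S.points m - z + (S.points k - S.points m) = S.points k - z by abel, hz k hki,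
        hz m hm, zero_add] at h
      rw [← h, if_neg hki.symm]
      ring
  have hn : outwardNormal S' i' = (S'.height i' * κ / S.height i) • outwardNormal S i := by
    refine ext_inner_right ℝ fun w => ?_
    have hh := (S.height_pos i).ne'
    rw [real_inner_smul_left, inner_outwardNormal, inner_outwardNormal, hlin,
      LinearMap.smul_apply, smul_eq_mul]
    field_simp
  have h1 := norm_outwardNormal (S := S') i'
  rw [hn, norm_smul, norm_outwardNormal, mul_one, Real.norm_eq_abs] at h1
  rw [hn]
  rcases (abs_eq zero_le_one).1 h1 with h | h <;> rw [h]
  · left; rw [one_smul]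
  · right; rw [neg_one_smul]

theorem eventually_sub_smul_outwardNormal_mem {x : Pt d} (hx : bary S i x = 0)
    (hx' : ∀ k, k ≠ i → 0 < bary S k x) :
    ∀ᶠ ε : ℝ in nhdsWithin 0 (Set.Ioi 0),
      x - ε • outwardNormal S i ∈ interior S.closedInterior := by
  have h : ∀ k, ∀ᶠ ε : ℝ in nhdsWithin 0 (Set.Ioi 0), 0 < bary S k (x - ε • outwardNormal S i) := by
    intro k
    rcases eq_or_ne k i with rfl | hk
    · filter_upwards [self_mem_nhdsWithin] with ε hε
      rw [sub_eq_add_neg, bary_add, hx, bary_linear, inner_neg_right, real_inner_smul_right,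
        real_inner_self_eq_norm_sq, norm_outwardNormal]
      have := S.height_pos k
      have hε' : 0 < ε := hε
      have : 0 < ε / S.height k := by positivity
      simpa [neg_div] using this
    · have hc : Continuous fun ε : ℝ => bary S k (x - ε • outwardNormal S i) :=
        (continuous_bary k).comp (by fun_prop)
      refine nhdsWithin_le_nhds (hc.continuousAt.eventually (lt_mem_nhds ?_))
      simpa using hx' k hk
  filter_upwards [Filter.eventually_all.2 h] with ε hε
  exact setOf_bary_pos_subset_interior hε

/-- If the normals agreed, a short step inward from a relative interior point of the facet would
enter both interiors, which are disjoint. -/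
theorem outwardNormal_eq_neg
    (hF : (S.faceOpposite i).closedInterior =
      (fun y => z + y) '' (S'.faceOpposite i').closedInterior)
    (hdisj : Disjoint (interior S.closedInterior)
      ((fun y => z + y) '' interior S'.closedInterior)) :
    outwardNormal S' i' = -outwardNormal S i := by
  refine (outwardNormal_eq_or_eq_neg hF).resolve_left fun heq => ?_
  obtain ⟨x, hx, hx'⟩ := exists_mem_facet_bary_pos (S := S) i
  have hxF : x ∈ (S.faceOpposite i).closedInterior := mem_facet_iff.2 ⟨hx, fun k => by
    rcases eq_or_ne k i with rfl | hk
    exacts [hx.ge, (hx' k hk).le]⟩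
  have hx0 : bary S' i' (x - z) = 0 := by
    rw [hF] at hxF
    obtain ⟨w, hw, rfl⟩ := hxF
    rw [add_sub_cancel_left]
    exact (mem_facet_iff.1 hw).1
  obtain ⟨ε, h1, h2⟩ := ((eventually_sub_smul_outwardNormal_mem hx hx').and
    (eventually_sub_smul_outwardNormal_mem hx0
      fun k hk => bary_pos_of_facet_eq hF hx hx' hk)).exists
  refine Set.disjoint_left.1 hdisj h1 ⟨_, h2, ?_⟩
  rw [heq]
  change z + (x - z - ε • outwardNormal S i) = _
  abel

end AdjacentSimplices

/-! ### Cancellation of facet contributions over the mesh. -/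

namespace PeriodicMesh

variable [NeZero d] (𝒯 : PeriodicMesh d)

theorem normal_nbr (s : 𝒯.Side) : 𝒯.normal (𝒯.nbr s) = -𝒯.normal s :=
  outwardNormal_eq_neg (𝒯.facet_eq s) (𝒯.disjoint _ _ _ (𝒯.shift_mem s)
    fun h => 𝒯.nbr_ne s h.symm)

theorem isInterface_nbr (s : 𝒯.Side) : 𝒯.IsInterface (𝒯.nbr s) ↔ 𝒯.IsInterface s := by
  unfold IsInterface
  rw [𝒯.nbr_nbr, 𝒯.shift_nbr, neg_eq_zero, eq_comm]

theorem facet_eq_image (s : 𝒯.Side) :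
    𝒯.facet s = (fun y => 𝒯.shift s + y) '' 𝒯.facet (𝒯.nbr s) := 𝒯.facet_eq s

theorem setIntegral_facet_nbr (s : 𝒯.Side) (f : Pt d → ℝ) :
    ∫ x in 𝒯.facet s, f x ∂μHE[d - 1] =
      ∫ x in 𝒯.facet (𝒯.nbr s), f (𝒯.shift s + x) ∂μHE[d - 1] := by
  have hmp : MeasurePreserving (fun y : Pt d => 𝒯.shift s + y) (μHE[d - 1]) (μHE[d - 1]) :=
    measurePreserving_add_left _ _
  rw [facet_eq_image]
  exact hmp.setIntegral_image_emb
    (MeasurableEquiv.addLeft (𝒯.shift s)).measurableEmbedding f _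

/-- A sum over sides cancels if the contributions seen from both sides of each facet do. -/
theorem sum_sides_eq_zero (A : Finset 𝒯.Side) (hA : ∀ s ∈ A, 𝒯.nbr s ∈ A) {I : 𝒯.Side → ℝ}
    (hI : ∀ s ∈ A, I s = -I (𝒯.nbr s)) : ∑ s ∈ A, I s = 0 := by
  have h1 : ∑ s ∈ A, I s = ∑ s ∈ A, I (𝒯.nbr s) :=
    Finset.sum_bij' (fun s _ => 𝒯.nbr s) (fun s _ => 𝒯.nbr s) hA hA
      (fun s _ => 𝒯.nbr_nbr s) (fun s _ => 𝒯.nbr_nbr s) (fun s _ => by rw [𝒯.nbr_nbr])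
  have h2 : ∑ s ∈ A, I s = -∑ s ∈ A, I (𝒯.nbr s) := by
    rw [← Finset.sum_neg_distrib]
    exact Finset.sum_congr rfl hI
  linarith

/-- A single-valued flux has no net contribution on the interfaces. -/
theorem boundaryIntegral_single_valued (ψ : 𝒯.Side → Pt d → Pt d → ℝ)
    (hψ : ∀ s, 𝒯.IsInterface s → ∀ x ∈ 𝒯.facet (𝒯.nbr s),
      ψ s (𝒯.shift s + x) (𝒯.normal s) = -ψ (𝒯.nbr s) x (𝒯.normal (𝒯.nbr s))) :
    𝒯.boundaryIntegral (fun s x => ψ s x (𝒯.normal s)) = 0 := by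
  classical
  unfold boundaryIntegral
  refine 𝒯.sum_sides_eq_zero _ (fun s hs => ?_) fun s hs => ?_
  · simpa [isInterface_nbr] using hs
  · rw [setIntegral_facet_nbr, ← integral_neg]
    exact setIntegral_congr_fun (measurableSet_facet (S := 𝒯.simplex (𝒯.nbr s).1) (𝒯.nbr s).2)
      fun x hx => hψ s (by simpa using hs) x hx

/-- Facets inside a macro-element do not contribute to the sum of the boundary integrals of a
function which is single-valued on each macro-element. -/
theorem sum_facets_eq_boundaryIntegral (ψ : 𝒯.Macro → Pt d → Pt d → ℝ)
    (hψ : ∀ i x n, ψ i x (-n) = -ψ i x n) :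
    ∑ s : 𝒯.Side, ∫ x in 𝒯.facet s, ψ (𝒯.owner s.1) x (𝒯.normal s) ∂μHE[d - 1] =
      𝒯.boundaryIntegral (fun s x => ψ (𝒯.owner s.1) x (𝒯.normal s)) := by
  classical
  rw [← Finset.sum_filter_add_sum_filter_not Finset.univ 𝒯.IsInterface]
  have h0 : ∑ s : 𝒯.Side with ¬ 𝒯.IsInterface s,
      ∫ x in 𝒯.facet s, ψ (𝒯.owner s.1) x (𝒯.normal s) ∂μHE[d - 1] = 0 := by
    refine 𝒯.sum_sides_eq_zero _ (fun s hs => ?_) fun s hs => ?_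
    · simpa [isInterface_nbr] using hs
    · obtain ⟨h1, h2⟩ : 𝒯.owner (𝒯.nbr s).1 = 𝒯.owner s.1 ∧ 𝒯.shift s = 0 := by
        simpa [IsInterface] using hs
      rw [setIntegral_facet_nbr, ← integral_neg, normal_nbr, h1]
      congr 1
      funext x
      rw [hψ, neg_neg, h2, zero_add]
  rw [h0, add_zero]
  unfold boundaryIntegral
  congr!

end PeriodicMesh

end EulerHDG

/-! ### Differentiation of the entropy integral in time. -/

namespace EulerHDG

variable {d : ℕ}

section Interpolation

/-- In a finite-dimensional space of functions every function is determined by, and depends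
linearly on, its values at finitely many fixed points. -/
theorem exists_interpolation {X : Type*} (V : Submodule ℝ (X → ℝ)) [FiniteDimensional ℝ V] :
    ∃ (N : Type) (_ : Fintype N) (x : N → X) (φ : N → X → ℝ), (∀ j, φ j ∈ V) ∧
      ∀ f ∈ V, ∀ y, f y = ∑ j, φ j y * f (x j) := by
  classical
  let ev : X → Module.Dual ℝ V := fun y => (LinearMap.proj y).comp V.subtype
  -- A function killed by all evaluations is zero, so evaluations span the dual. A basis of the dual
  -- consisting of evaluations provides the nodes.
  have hspan : ⊤ ≤ Submodule.span ℝ (Set.range ev) := by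
    have h := Subspace.dualCoannihilator_dualAnnihilator_eq (W := Submodule.span ℝ (Set.range ev))
    have h0 : (Submodule.span ℝ (Set.range ev)).dualCoannihilator = ⊥ := by
      rw [eq_bot_iff]
      intro f hf
      rw [Submodule.mem_dualCoannihilator] at hf
      rw [Submodule.mem_bot]
      exact Subtype.ext (funext fun y => hf (ev y) (Submodule.subset_span ⟨y, rfl⟩))
    rw [← h, h0, Submodule.dualAnnihilator_bot]
  let b := Module.Basis.ofSpan hspan
  let b' := b.reindex (b.indexEquiv (Module.finBasis ℝ (Module.Dual ℝ V)))
  have hb : ∀ j, ∃ y, ev y = b' j := fun j => by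
    have : b' j ∈ Set.range b := by rw [Module.Basis.reindex_apply]; exact ⟨_, rfl⟩
    exact Module.Basis.ofSpan_subset hspan this
  choose x hx using hb
  let E : V →ₗ[ℝ] (Fin (Module.finrank ℝ (Module.Dual ℝ V)) → ℝ) :=
    LinearMap.pi fun j => ev (x j)
  have hE : LinearMap.ker E = ⊥ := by
    rw [eq_bot_iff]
    intro f hf
    rw [Submodule.mem_bot, ← Module.forall_dual_apply_eq_zero_iff ℝ]
    intro φ
    have h1 : ∀ j, b' j f = 0 := fun j => by
      rw [← hx]; exact congrFun (LinearMap.mem_ker.1 hf) j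
    rw [← b'.sum_repr φ, LinearMap.sum_apply]
    exact Finset.sum_eq_zero fun j _ => by rw [LinearMap.smul_apply, h1, smul_zero]
  -- The images of the unit vectors under a left inverse of evaluation at the nodes serve as nodal
  -- basis functions.
  obtain ⟨g, hg⟩ := E.exists_leftInverse_of_injective hE
  refine ⟨_, inferInstance, x, fun j => (g (Pi.single j 1) : V), fun j => (g _).2, fun f hf y => ?_⟩
  have h1 : g (E ⟨f, hf⟩) = ⟨f, hf⟩ := LinearMap.congr_fun hg _
  have h2 : E ⟨f, hf⟩ = ∑ j, f (x j) • (Pi.single j 1 : Fin _ → ℝ) := by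
    funext k
    simp [Finset.sum_apply, Pi.single_apply, E, ev]
  rw [h2, map_sum] at h1
  have h3 := congrArg (fun w : V => (w : X → ℝ) y) h1
  simp only [map_smul, Submodule.coe_sum, Submodule.coe_smul, Finset.sum_apply, Pi.smul_apply,
    smul_eq_mul] at h3
  rw [← h3]
  exact Finset.sum_congr rfl fun j _ => mul_comm _ _

/-- Polynomials of bounded degree on a set depend on finitely many of their values. -/
theorem exists_polynomial_interpolation (p : ℕ) (D : Set (Pt d)) :
    ∃ (N : Type) (_ : Fintype N) (x : N → Pt d) (φ : N → Pt d → ℝ), (∀ j, x j ∈ D) ∧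
      (∀ j, ContinuousOn (φ j) D) ∧
      ∀ f : Pt d → State d, IsPolyOn p D f → ∀ y ∈ D, f y = ∑ j, φ j y • f (x j) := by
  -- Restricting polynomials to `D` forces the nodes into `D`, where time differentiability of the
  -- discrete solution is available.
  let R : MvPolynomial (Fin d) ℝ →ₗ[ℝ] (D → ℝ) :=
    { toFun := fun q y => MvPolynomial.eval (fun i => (y : Pt d) i) q
      map_add' := fun q r => by funext y; simp
      map_smul' := fun a q => by funext y; simp }
  let V := (MvPolynomial.restrictTotalDegree (Fin d) ℝ p).map R
  obtain ⟨N, hN, x, φ, hφ, h⟩ := exists_interpolation V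
  have hφ' : ∀ j, ∃ q : MvPolynomial (Fin d) ℝ, ∀ y : D,
      φ j y = MvPolynomial.eval (fun i => (y : Pt d) i) q := fun j => by
    obtain ⟨q, -, hq⟩ := hφ j
    exact ⟨q, fun y => (congrFun hq y).symm⟩
  choose q hq using hφ'
  refine ⟨N, hN, fun j => x j, fun j y => MvPolynomial.eval (fun i => y i) (q j),
    fun j => (x j).2, fun j => ?_, fun f hf y hy => ?_⟩
  · exact ((MvPolynomial.continuous_eval (q j)).comp (by fun_prop)).continuousOn
  · funext c
    obtain ⟨r, hr, hr'⟩ := hf c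
    have hmem : (fun y : D => f y c) ∈ V :=
      ⟨r, (MvPolynomial.mem_restrictTotalDegree _ _ _).2 hr, funext fun y => (hr' y y.2).symm⟩
    have := h _ hmem ⟨y, hy⟩
    simp only [hq] at this
    rw [this]
    simp [Finset.sum_apply]

end Interpolation

section ParametricIntegral

open Topology

/-- In the application `c` is the vector of nodal values and `A x` evaluates the interpolant at `x`.
The values `A x c₀` fill a compact subset of `U`, and so does a small closed thickening of them;
there the derivative of `G` is bounded, which provides the dominating function. -/
theorem hasFDerivAt_integral_comp_clm {P E : Type*} [NormedAddCommGroup P] [NormedSpace ℝ P]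
    [NormedAddCommGroup E] [NormedSpace ℝ E] [ProperSpace E] {K : Set (Pt d)} (hK : IsCompact K)
    {A : Pt d → P →L[ℝ] E} (hA : ContinuousOn A K) {U : Set E} (hU : IsOpen U) {G : E → ℝ}
    (hG : ContDiffOn ℝ 1 G U) {c₀ : P} (hc₀ : ∀ x ∈ K, A x c₀ ∈ U) :
    IntegrableOn (fun x => (fderiv ℝ G (A x c₀)).comp (A x)) K ∧
    HasFDerivAt (fun c => ∫ x in K, G (A x c)) (∫ x in K, (fderiv ℝ G (A x c₀)).comp (A x)) c₀ := by
  have hG' : ContinuousOn (fderiv ℝ G) U := hG.continuousOn_fderiv_of_isOpen hU le_rfl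
  have hGd : ∀ y ∈ U, HasFDerivAt G (fderiv ℝ G y) y := fun y hy =>
    ((hG.differentiableOn one_ne_zero).differentiableAt (hU.mem_nhds hy)).hasFDerivAt
  have hA0 : ContinuousOn (fun x => A x c₀) K := hA.clm_apply continuousOn_const
  have hQ : IsCompact ((fun x => A x c₀) '' K) := hK.image_of_continuousOn hA0
  obtain ⟨δ, hδ, hδU⟩ := hQ.exists_cthickening_subset_open hU (Set.image_subset_iff.2 hc₀)
  obtain ⟨M, hM⟩ := hQ.cthickening.exists_bound_of_continuousOn (hG'.mono hδU)
  obtain ⟨B, hB⟩ := hK.exists_bound_of_continuousOn hA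
  have hB' : ∀ x ∈ K, ‖A x‖ ≤ max B 0 := fun x hx => (hB x hx).trans (le_max_left _ _)
  have hB0 : 0 ≤ max B 0 := le_max_right _ _
  -- Moving `c` by `ε` moves `A x c` by at most `δ`; the summand 1 keeps the denominator positive.
  set ε := δ / (max B 0 + 1) with hε
  have hε0 : 0 < ε := by positivity
  have hmem : ∀ c ∈ Metric.ball c₀ ε, ∀ x ∈ K,
      A x c ∈ Metric.cthickening δ ((fun x => A x c₀) '' K) := by
    intro c hc x hx
    refine Metric.mem_cthickening_of_dist_le _ _ _ _ (Set.mem_image_of_mem _ hx) ?_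
    rw [dist_eq_norm, ← map_sub]
    have h1 : ‖c - c₀‖ ≤ ε := by rw [← dist_eq_norm]; exact (Metric.mem_ball.1 hc).le
    calc ‖A x (c - c₀)‖ ≤ ‖A x‖ * ‖c - c₀‖ := (A x).le_opNorm _
      _ ≤ (max B 0 + 1) * ε := by
          refine mul_le_mul ?_ h1 (norm_nonneg _) (by positivity)
          linarith [hB' x hx]
      _ = δ := by rw [hε]; field_simp
  have hcont : ∀ c ∈ Metric.ball c₀ ε, ContinuousOn (fun x => G (A x c)) K := fun c hc =>
    hG.continuousOn.comp (hA.clm_apply continuousOn_const) fun x hx => hδU (hmem c hc x hx)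
  have hder : ContinuousOn (fun x => (fderiv ℝ G (A x c₀)).comp (A x)) K :=
    (hG'.comp hA0 hc₀).clm_comp hA
  have hball : Metric.ball c₀ ε ∈ 𝓝 c₀ := Metric.ball_mem_nhds _ hε0
  have hKm := hK.measurableSet
  have : IsFiniteMeasure (volume.restrict K) :=
    ⟨by rw [Measure.restrict_apply_univ]; exact hK.measure_lt_top⟩
  refine ⟨hder.integrableOn_compact hK, ?_⟩
  refine hasFDerivAt_integral_of_dominated_of_fderiv_le (s := Metric.ball c₀ ε)
    (F := fun c x => G (A x c)) (F' := fun c x => (fderiv ℝ G (A x c)).comp (A x))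
    (bound := fun _ => max M 0 * max B 0) hball ?_ ?_ ?_ ?_ (integrable_const _) ?_
  · filter_upwards [hball] with c hc
    exact (hcont c hc).aestronglyMeasurable hKm
  · exact (hcont c₀ (Metric.mem_ball_self hε0)).integrableOn_compact hK
  · exact hder.aestronglyMeasurable_of_isCompact hK hKm
  · refine ae_restrict_of_forall_mem hKm fun x hx c hc => ?_
    refine (ContinuousLinearMap.opNorm_comp_le _ _).trans ?_
    exact mul_le_mul ((hM _ (hmem c hc x hx)).trans (le_max_left _ _)) (hB' x hx)
      (norm_nonneg _) (le_max_right _ _)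
  · refine ae_restrict_of_forall_mem hKm fun x hx c hc => ?_
    exact (hGd _ (hδU (hmem c hc x hx))).comp c (A x).hasFDerivAt

end ParametricIntegral

section EntropyRate

/-- The rate of change of the entropy in one element. -/
theorem hasDerivWithinAt_integral_genEntropy {γ T : ℝ} (hγ : 1 < γ) (hT : 0 < T) {p : ℕ}
    {K : Set (Pt d)} (hK : IsCompact K) {v : ℝ → Pt d → State d}
    (hv : ∀ t ∈ Set.Icc 0 T, IsPolyOn p K (v t))
    (hadm : ∀ t ∈ Set.Icc 0 T, ∀ x ∈ K, Admissible (v t x))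
    (hdiff : ∀ x ∈ K, DifferentiableOn ℝ (fun t => v t x) (Set.Icc 0 T))
    {t : ℝ} (ht : t ∈ Set.Icc 0 T) :
    HasDerivWithinAt (fun t => ∫ x in K, genEntropy γ (consVars γ (v t x)))
      (∫ x in K, derivWithin (fun τ => consVars γ (v τ x)) (Set.Icc 0 T) t ⬝ᵥ v t x)
      (Set.Icc 0 T) t := by
  -- Differentiability in time for each `x` separately gives no bound uniform in `x`. Interpolation
  -- supplies it: `v t` depends linearly on finitely many nodal values, each differentiable in time.
  obtain ⟨N, _, y, φ, hy, hφ, hint⟩ := exists_polynomial_interpolation p K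
  let A : Pt d → (N → State d) →L[ℝ] State d := fun x =>
    ∑ j, φ j x • ContinuousLinearMap.proj (R := ℝ) (φ := fun _ : N => State d) j
  have hA : ContinuousOn A K :=
    continuousOn_finsetSum _ fun j _ => (hφ j).smul continuousOn_const
  let c : ℝ → N → State d := fun τ j => v τ (y j)
  have hAc : ∀ τ ∈ Set.Icc 0 T, ∀ x ∈ K, A x (c τ) = v τ x := fun τ hτ x hx => by
    rw [hint _ (hv τ hτ) x hx]
    simp [A, c]
  have hud : UniqueDiffWithinAt ℝ (Set.Icc 0 T) t := uniqueDiffOn_Icc hT t ht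
  have hc : HasDerivWithinAt c (fun j => derivWithin (fun τ => v τ (y j)) (Set.Icc 0 T) t)
      (Set.Icc 0 T) t :=
    hasDerivWithinAt_pi.2 fun j => (hdiff _ (hy j) t ht).hasDerivWithinAt
  set c' : N → State d := fun j => derivWithin (fun τ => v τ (y j)) (Set.Icc 0 T) t
  obtain ⟨hI, hJ⟩ := hasFDerivAt_integral_comp_clm hK hA isOpen_admissible
    (G := fun w : State d => genEntropy γ (consVars γ w))
    (fun w hw => ((contDiffAt_genEntropy_consVars hγ hw).of_le (by simp)).contDiffWithinAt)
    (c₀ := c t) (fun x hx => by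
      rw [hAc t ht x hx]; exact hadm t ht x hx)
  refine ((hJ.comp_hasDerivWithinAt t hc).congr (fun τ hτ => ?_) ?_).congr_deriv ?_
  · exact setIntegral_congr_fun hK.measurableSet fun x hx => by simp only [hAc τ hτ x hx]
  · exact setIntegral_congr_fun hK.measurableSet fun x hx => by simp only [hAc t ht x hx]
  · rw [ContinuousLinearMap.integral_apply hI]
    refine setIntegral_congr_fun hK.measurableSet fun x hx => ?_
    have h1 : HasDerivWithinAt (fun τ => v τ x) (A x c') (Set.Icc 0 T) t :=
      ((A x).hasFDerivAt.comp_hasDerivWithinAt t hc).congr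
        (fun τ hτ => (hAc τ hτ x hx).symm) (hAc t ht x hx).symm
    -- Differentiation under the integral yields the chain-rule form `h3`, the claim has the form
    -- `h2`; they agree because derivatives within `[0, T]` are unique when `T > 0`.
    have h2 := hasDerivWithinAt_genEntropy hγ (fun τ hτ => hadm τ hτ x hx) ht h1
    have h3 := (((contDiffAt_genEntropy_consVars hγ (hadm t ht x hx)).differentiableAt
      (by simp)).hasFDerivAt).comp_hasDerivWithinAt t h1
    have h4 := hud.eq_deriv _ h3 h2
    simpa only [ContinuousLinearMap.comp_apply, hAc t ht x hx] using h4

end EntropyRate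

end EulerHDG

/-! ### The scheme tested with its own solution. -/

namespace EulerHDG

variable {d : ℕ}

theorem contDiff_eval_mvPolynomial (q : MvPolynomial (Fin d) ℝ) :
    ContDiff ℝ ⊤ (fun x : Pt d => MvPolynomial.eval (fun i => x i) q) := by
  induction q using MvPolynomial.induction_on with
  | C a => simpa using contDiff_const
  | add q r hq hr => simpa using hq.add hr
  | mul_X q i hq =>
    simp only [map_mul, MvPolynomial.eval_X]
    exact hq.mul (by fun_prop)

/-- Only the values of `f` on `D` are controlled; the polynomial extension gives smoothness up to
the boundary. -/
theorem IsPolyOn.exists_contDiff {p : ℕ} {D : Set (Pt d)} {f : Pt d → State d}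
    (hf : IsPolyOn p D f) : ∃ q : Pt d → State d, ContDiff ℝ ⊤ q ∧ Set.EqOn f q D := by
  choose q _ hq using hf
  exact ⟨fun x c => MvPolynomial.eval (fun i => x i) (q c),
    contDiff_pi.2 fun c => contDiff_eval_mvPolynomial (q c), fun x hx => funext fun c => hq c x hx⟩

theorem IsPolyOn.continuousOn {p : ℕ} {D : Set (Pt d)} {f : Pt d → State d}
    (hf : IsPolyOn p D f) : ContinuousOn f D := by
  obtain ⟨q, hq, hfq⟩ := hf.exists_contDiff
  exact hq.continuous.continuousOn.congr hfq

section MassFlux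

variable {γ : ℝ}

theorem contDiffAt_momC_consVars {v : State d} (hv : Admissible v) (j : Fin d) :
    ContDiffAt ℝ ⊤ (fun v : State d => momC (consVars γ v) j) v :=
  contDiffAt_pi.1 (contDiffAt_consVars γ hv) (Sum.inr (Sum.inl j))

theorem fderiv_momC_consVars (hγ : 1 < γ) {v : State d} (hv : Admissible v) (j : Fin d)
    (w : State d) :
    fderiv ℝ (fun v : State d => momC (consVars γ v) j) v w =
      eulerFlux γ (consVars γ v) j ⬝ᵥ w := by
  have hc : HasDerivWithinAt (fun τ : ℝ => v + τ • w) w Set.univ 0 := by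
    simpa using ((hasDerivWithinAt_id (0 : ℝ) Set.univ).smul_const w).const_add v
  have h0 : v + (0 : ℝ) • w = v := by simp
  have h1 := hasDerivWithinAt_massFlux hγ (c := fun τ : ℝ => v + τ • w) (t := 0)
    (by simpa using hv) hc j
  have h2 := ((contDiffAt_momC_consVars (γ := γ) (v := v + (0 : ℝ) • w) (by simpa using hv)
    j).differentiableAt (by simp)).hasFDerivAt.comp_hasDerivWithinAt 0 hc
  have h3 := uniqueDiffWithinAt_univ.eq_deriv _ h2 h1
  simpa only [h0] using h3

variable [NeZero d] {S : Affine.Simplex ℝ (Pt d) d}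

/-- The volume flux term of one element is a boundary term when the scheme is tested with the
entropy variables. -/
theorem integral_eulerFlux_dotProduct_fderiv (hγ : 1 < γ) {p : ℕ} {w : Pt d → State d}
    (hw : IsPolyOn p S.closedInterior w) (hadm : ∀ x ∈ S.closedInterior, Admissible (w x)) :
    ∫ x in S.closedInterior, ∑ j, eulerFlux γ (consVars γ (w x)) j ⬝ᵥ
        fderivWithin ℝ w S.closedInterior x (EuclideanSpace.single j 1) =
      ∑ i, ∫ x in (S.faceOpposite i).closedInterior,
        ∑ j, momC (consVars γ (w x)) j * outwardNormal S i j ∂μHE[d - 1] := by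
  have hK : IsCompact S.closedInterior := S.isCompact_closedInterior
  have hwc := hw.continuousOn
  obtain ⟨q, hq, hwq⟩ := hw.exists_contDiff
  have hwd : ∀ x ∈ S.closedInterior, HasFDerivWithinAt w (fderiv ℝ q x) S.closedInterior x :=
    fun x hx => (((hq.differentiable (by simp)) x).hasFDerivAt.hasFDerivWithinAt).congr hwq (hwq hx)
  have hwd' : ∀ x ∈ S.closedInterior, fderivWithin ℝ w S.closedInterior x = fderiv ℝ q x :=
    fun x hx => (hwd x hx).fderivWithin (uniqueDiffOn_closedInterior x hx)
  have hqc : Continuous (fderiv ℝ q) := hq.continuous_fderiv (by simp)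
  let G : Fin d → State d → ℝ := fun j v => momC (consVars γ v) j
  have hG : ∀ j, ∀ x ∈ S.closedInterior, HasFDerivWithinAt (fun x => G j (w x))
      ((fderiv ℝ (G j) (w x)).comp (fderiv ℝ q x)) S.closedInterior x := fun j x hx =>
    (((contDiffAt_momC_consVars (hadm x hx) j).differentiableAt
      (by simp)).hasFDerivAt).comp_hasFDerivWithinAt x (hwd x hx)
  have hG' : ∀ j, ContinuousOn (fun x => (fderiv ℝ (G j) (w x)).comp (fderiv ℝ q x))
      S.closedInterior := by
    intro j
    have h1 : ContinuousOn (fderiv ℝ (G j)) {v | Admissible v} :=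
      ContDiffOn.continuousOn_fderiv_of_isOpen (n := ⊤)
        (fun v hv => (contDiffAt_momC_consVars hv j).contDiffWithinAt) isOpen_admissible (by simp)
    exact (h1.comp hwc hadm).clm_comp hqc.continuousOn
  -- Since `F_j = ∂(ρ V_j)/∂v`, the chain rule turns the integrand into the divergence of `ρV`.
  have e1 : ∫ x in S.closedInterior, ∑ j, eulerFlux γ (consVars γ (w x)) j ⬝ᵥ
        fderivWithin ℝ w S.closedInterior x (EuclideanSpace.single j 1) =
      ∫ x in S.closedInterior, ∑ j, (fderiv ℝ (G j) (w x)).comp (fderiv ℝ q x)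
        (EuclideanSpace.single j 1) := by
    refine setIntegral_congr_fun hK.measurableSet fun x hx => Finset.sum_congr rfl fun j _ => ?_
    rw [hwd' x hx, ContinuousLinearMap.comp_apply, fderiv_momC_consVars hγ (hadm x hx)]
  rw [e1, integral_finsetSum _ fun j _ =>
    ((hG' j).clm_apply continuousOn_const).integrableOn_compact hK]
  simp only [integral_fderiv_simplex (hG _) (hG' _)]
  rw [Finset.sum_comm]
  refine Finset.sum_congr rfl fun i _ => ?_
  rw [← integral_finsetSum]
  · simp only [EuclideanSpace.inner_single_right]
    simp [G]
  · intro j _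
    refine integrableOn_facet i (ContinuousOn.mul ?_ continuousOn_const)
    exact (continuousOn_momC hwc hadm j).mono
      (S.closedInterior_faceOpposite_subset_closedInterior i)

end MassFlux

namespace PeriodicMesh

variable [NeZero d] {𝒯 : PeriodicMesh d} {γ T : ℝ} {p : ℕ}

theorem facet_subset_cell (s : 𝒯.Side) : 𝒯.facet s ⊆ 𝒯.cell s.1 :=
  (𝒯.simplex s.1).closedInterior_faceOpposite_subset_closedInterior s.2

theorem cell_subset_macroCell (K : 𝒯.Elem) : 𝒯.cell K ⊆ 𝒯.macroCell (𝒯.owner K) := fun _ hx =>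
  Set.mem_biUnion (show K ∈ {K' | 𝒯.owner K' = 𝒯.owner K} from rfl) hx

theorem facet_subset_macroCell (s : 𝒯.Side) : 𝒯.facet s ⊆ 𝒯.macroCell (𝒯.owner s.1) :=
  (𝒯.facet_subset_cell s).trans (𝒯.cell_subset_macroCell s.1)

/-- The volume flux term of the scheme tested with the entropy variables. -/
theorem volumeIntegral_eulerFlux (hγ : 1 < γ) {w : 𝒯.Macro → Pt d → State d}
    (hw : w ∈ 𝒯.volumeSpace p) (hadm : ∀ i, ∀ x ∈ 𝒯.macroCell i, Admissible (w i x)) :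
    𝒯.volumeIntegral (fun K x => ∑ j, eulerFlux γ (consVars γ (w (𝒯.owner K) x)) j ⬝ᵥ
        fderivWithin ℝ (w (𝒯.owner K)) (𝒯.cell K) x (EuclideanSpace.single j 1)) =
      𝒯.boundaryIntegral (fun s x =>
        ∑ j, momC (consVars γ (w (𝒯.owner s.1) x)) j * 𝒯.normal s j) := by
  rw [← 𝒯.sum_facets_eq_boundaryIntegral
    (fun i x n => ∑ j, momC (consVars γ (w i x)) j * n j) (fun i x n => by simp),
    Fintype.sum_prod_type]
  exact Finset.sum_congr rfl fun K _ => integral_eulerFlux_dotProduct_fderiv hγ (hw.2 K)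
    fun x hx => hadm _ x (𝒯.cell_subset_macroCell K hx)

/-- The trace, hence `ρV`, is the same from both sides of an interface, while the normals are
opposite. -/
theorem boundaryIntegral_trace_massFlux {μ : 𝒯.Side → Pt d → State d}
    (hμ : μ ∈ 𝒯.traceSpace p) :
    𝒯.boundaryIntegral (fun s x => ∑ j, momC (consVars γ (μ s x)) j * 𝒯.normal s j) = 0 := by
  refine 𝒯.boundaryIntegral_single_valued
    (fun s x n => ∑ j, momC (consVars γ (μ s x)) j * n j) fun s hs x hx => ?_
  rw [(hμ s hs).2 x hx, normal_nbr]
  simp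

theorem hasDerivWithinAt_totalEntropy (hγ : 1 < γ) (hT : 0 < T)
    {v : ℝ → 𝒯.Macro → Pt d → State d}
    (hv : ∀ t ∈ Set.Icc 0 T, v t ∈ 𝒯.volumeSpace p)
    (hadm : ∀ t ∈ Set.Icc 0 T, ∀ i, ∀ x ∈ 𝒯.macroCell i, Admissible (v t i x))
    (hdiff : ∀ i, ∀ x ∈ 𝒯.macroCell i, DifferentiableOn ℝ (fun t => v t i x) (Set.Icc 0 T))
    {t : ℝ} (ht : t ∈ Set.Icc 0 T) :
    HasDerivWithinAt (fun t => 𝒯.totalEntropy γ (v t))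
      (𝒯.volumeIntegral fun K x => derivWithin (fun τ => consVars γ (v τ (𝒯.owner K) x))
        (Set.Icc 0 T) t ⬝ᵥ v t (𝒯.owner K) x) (Set.Icc 0 T) t :=
  HasDerivWithinAt.fun_sum fun K _ => hasDerivWithinAt_integral_genEntropy hγ hT
    (𝒯.simplex K).isCompact_closedInterior (fun t ht => (hv t ht).2 K)
    (fun t ht x hx => hadm t ht _ x (𝒯.cell_subset_macroCell K hx))
    (fun x hx => hdiff _ x (𝒯.cell_subset_macroCell K hx)) ht

/-- The net boundary term is nonpositive: generalized entropy is dissipated at every point of the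
interfaces. -/
theorem boundaryIntegral_kepes_nonpos (hγ : 1 < γ) {lam : State d → State d → Pt d → ℝ}
    (hlam : lam = (fun vh _ n => lamMaxTrace γ vh n) ∨ lam = lamMaxMean γ)
    (frame : 𝒯.Side → OrthonormalBasis (Fin d) ℝ (Pt d))
    {w : 𝒯.Macro → Pt d → State d} (hw : w ∈ 𝒯.volumeSpace p)
    (hadm : ∀ i, ∀ x ∈ 𝒯.macroCell i, Admissible (w i x))
    {μ : 𝒯.Side → Pt d → State d} (hμ : μ ∈ 𝒯.traceSpace p)
    (hadm' : ∀ s, 𝒯.IsInterface s → ∀ x ∈ 𝒯.facet s, Admissible (μ s x)) :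
    𝒯.boundaryIntegral (fun s x =>
        kepesFlux γ (μ s x) (w (𝒯.owner s.1) x)
          (lam (μ s x) (w (𝒯.owner s.1) x) (𝒯.normal s)) (frame s) (𝒯.normal s) ⬝ᵥ μ s x)
      - 𝒯.boundaryIntegral (fun s x =>
        kepesFlux γ (μ s x) (w (𝒯.owner s.1) x)
          (lam (μ s x) (w (𝒯.owner s.1) x) (𝒯.normal s)) (frame s) (𝒯.normal s) ⬝ᵥ
            w (𝒯.owner s.1) x)
      - (𝒯.boundaryIntegral (fun s x => ∑ j, momC (consVars γ (μ s x)) j * 𝒯.normal s j)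
        - 𝒯.boundaryIntegral (fun s x =>
          ∑ j, momC (consVars γ (w (𝒯.owner s.1) x)) j * 𝒯.normal s j)) ≤ 0 := by
  classical
  unfold boundaryIntegral
  rw [← Finset.sum_sub_distrib, ← Finset.sum_sub_distrib, ← Finset.sum_sub_distrib]
  refine Finset.sum_nonpos fun s hs => ?_
  have hs' : 𝒯.IsInterface s := by simpa using hs
  have hwc : ContinuousOn (w (𝒯.owner s.1)) (𝒯.facet s) :=
    (hw.1 _).mono (𝒯.facet_subset_macroCell s)
  have hwa : ∀ x ∈ 𝒯.facet s, Admissible (w (𝒯.owner s.1) x) := fun x hx =>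
    hadm _ x (𝒯.facet_subset_macroCell s hx)
  have hμc : ContinuousOn (μ s) (𝒯.facet s) := (hμ s hs').1.continuousOn
  have hμa := hadm' s hs'
  have hF := continuousOn_kepesFlux hγ hμc hμa hwc hwa hlam (frame s) (𝒯.normal s)
  have hdot : ∀ {f g : Pt d → State d}, ContinuousOn f (𝒯.facet s) →
      ContinuousOn g (𝒯.facet s) → ContinuousOn (fun x => f x ⬝ᵥ g x) (𝒯.facet s) :=
    fun hf hg => continuousOn_finsetSum _ fun k _ =>
      (continuousOn_pi.1 hf k).mul (continuousOn_pi.1 hg k)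
  have hψ : ∀ {f : Pt d → State d}, ContinuousOn f (𝒯.facet s) →
      (∀ x ∈ 𝒯.facet s, Admissible (f x)) →
      ContinuousOn (fun x => ∑ j, momC (consVars γ (f x)) j * 𝒯.normal s j) (𝒯.facet s) :=
    fun hf hf' => continuousOn_finsetSum _ fun j _ =>
      (continuousOn_momC hf hf' j).mul continuousOn_const
  -- Integrability allows the four integrals to be merged and compared pointwise.
  have I1 : IntegrableOn _ (𝒯.facet s) μHE[d - 1] :=
    integrableOn_facet s.2 (S := 𝒯.simplex s.1) (hdot hF hμc)
  have I2 : IntegrableOn _ (𝒯.facet s) μHE[d - 1] :=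
    integrableOn_facet s.2 (S := 𝒯.simplex s.1) (hdot hF hwc)
  have I3 : IntegrableOn _ (𝒯.facet s) μHE[d - 1] :=
    integrableOn_facet s.2 (S := 𝒯.simplex s.1) (hψ hμc hμa)
  have I4 : IntegrableOn _ (𝒯.facet s) μHE[d - 1] :=
    integrableOn_facet s.2 (S := 𝒯.simplex s.1) (hψ hwc hwa)
  beta_reduce
  rw [← integral_sub I1 I2, ← integral_sub I3 I4, sub_nonpos]
  refine setIntegral_mono_on (I1.sub I2) (I3.sub I4)
    (measurableSet_facet (S := 𝒯.simplex s.1) s.2) fun x hx => ?_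
  rw [← dotProduct_sub]
  exact kepesFlux_dotProduct_le hγ (hμa x hx) (hwa x hx) _ _ _

end PeriodicMesh

end EulerHDG

theorem theorem3 {d : ℕ} [NeZero d] (𝒯 : PeriodicMesh d) (p : ℕ) (γ T : ℝ) (hγ : 1 < γ)
    (lam : State d → State d → Pt d → ℝ)
    (hlam : lam = (fun vh _ n => lamMaxTrace γ vh n) ∨ lam = lamMaxMean γ)
    (frame : 𝒯.Side → OrthonormalBasis (Fin d) ℝ (Pt d))
    (M : Submodule ℝ (𝒯.Side → Pt d → State d)) (hM : M ≤ 𝒯.traceSpace p)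
    (v : ℝ → 𝒯.Macro → Pt d → State d) (vhat : ℝ → 𝒯.Side → Pt d → State d)
    (hsol : 𝒯.IsSolution γ T p M
      (fun s vh v n => kepesFlux γ vh v (lam vh v n) (frame s) n) v vhat) :
    AntitoneOn (fun t => 𝒯.totalEntropy γ (v t)) (Set.Icc 0 T) := by
  -- For `T ≤ 0` the interval has at most one point; derivatives within it are meaningful only for
  -- `T > 0`.
  rcases le_or_gt T 0 with hT | hT
  · exact (Set.subsingleton_Icc_of_ge hT).antitoneOn _
  have hder := fun t (ht : t ∈ Set.Icc 0 T) => PeriodicMesh.hasDerivWithinAt_totalEntropy hγ hT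
    hsol.mem_volume hsol.admissible_volume hsol.differentiable ht
  refine antitoneOn_of_hasDerivWithinAt_nonpos (convex_Icc 0 T)
    (fun t ht => (hder t ht).continuousWithinAt)
    (fun t ht => (hder t (interior_subset ht)).mono interior_subset) fun t ht => ?_
  replace ht := interior_subset ht
  -- The unknowns are the entropy variables themselves, so the solution is an admissible test
  -- function.
  have h1 := hsol.volume_eq t ht (v t) (hsol.mem_volume t ht)
  have h2 := hsol.trace_eq t ht (vhat t) (hsol.mem_trace t ht)
  have h3 := PeriodicMesh.boundaryIntegral_trace_massFlux (γ := γ) (hM (hsol.mem_trace t ht))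
  have h4 := PeriodicMesh.boundaryIntegral_kepes_nonpos hγ hlam frame (hsol.mem_volume t ht)
    (hsol.admissible_volume t ht) (hM (hsol.mem_trace t ht)) (hsol.admissible_trace t ht)
  rw [PeriodicMesh.volumeIntegral_eulerFlux hγ (hsol.mem_volume t ht)
    (hsol.admissible_volume t ht)] at h1
  rw [h3] at h4
  linarith
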